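/- Let $R$ be a commutative unitary ring containing $\mathbb{Q}$, $\mathbb{N}=\{0,1,2,\dots\}$, $\mathbb{P}=\{1,2,\dots\}$, and let $X=\{x_i\mid i\in\mathbb{P}\}$ be commuting variables. *Regularization.* For $k\ge 0$, $\alpha\in\mathbb{N}^k$ and $\beta\in\mathbb{P}^k$ consider $$\phi(\alpha;\beta)=\sum_{0<i_1<\cdots<i_k}x_{i_1}^{\alpha_1}\cdots x_{i_k}^{\alpha_k}\,e^{(i_1+t)\beta_1z}\cdots e^{(i_k+t)\beta_kz}\qquad(t\ge 0,\ \operatorname{Re} z<0).$$ The coefficient of each monomial in $X$ converges absolutely, and there is exactly one element of $\mathbb{Q}[[X]][t][z^{-1},z]]$ (Laurent series in $z$ whose coefficients are polynomials in $t$ over $\mathbb{Q}[[X]]$) which, for each monomial and each $t\ge0$, gives the Laurent expansion of that coefficient near $z=0$. This element, viewed in $R[[X]][t][z^{-1},z]]$, is again denoted $\phi(\alpha;\beta)$. *Renormalization.* Let $P$ be the projection of a Laurent series in $z$ onto its polar part $\sum_{n<0}a_nz^n$. The Algebraic Birkhoff Factorization $\phi=\phi_+\star\phi_-^{\star(-1)}$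 with respect to the deconcatenation coproduct is given by $\phi_\pm(\emptyset)=1$ and, for $k\ge1$, $$\phi_-(\alpha;\beta)=-P(F),\qquad \phi_+(\alpha;\beta)=(\mathrm{id}-P)(F),$$ $$F=\phi(\alpha;\beta)+\sum_{i=1}^{k-1}\phi(\alpha_1,\dots,\alpha_i;\beta_1,\dots,\beta_i)\,\phi_-(\alpha_{i+1},\dots,\alpha_k;\beta_{i+1},\dots,\beta_k).$$ Put $Z(\alpha;\beta):=\phi_+(\alpha;\beta)|_{z=0}\in R[[X]][t]$. *Notation.* For $\alpha\in\mathbb{N}^k$ let $j\in\{0,\dots,k\}$ be such that $\alpha_{j+1}=\cdots=\alpha_k=0$ and either $j=0$ or $\alpha_j>0$. Let $\mathfrak{S}_\alpha$ be the group of permutations of $\{1,\dots,k-j\}$ and $$Z(\alpha;\beta)^{\mathfrak{S}_\alpha}:=\sum_{\sigma\in\mathfrak{S}_\alpha}Z(\alpha_1,\dots,\alpha_k;\ \beta_1,\dots,\beta_j,\beta_{j+\sigma(1)},\dots,\beta_{j+\sigma(k-j)}).$$ For $\delta\in\mathbb{P}$ write $\alpha+\delta=(\alpha_1+\delta,\dots,\alpha_k+\delta)$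 and $\delta^k=(\delta,\dots,\delta)$ ($k$ entries); $0^s$ denotes $s$ zeros. **Theorem.** Let $\alpha\in\mathbb{N}^k$ be a weak composition and $\delta\in\mathbb{P}$ (with $k\ge1$ in (1)–(3)). 1. If $\alpha_k>0$, then $M_\alpha:=\sum_{0<i_1<\cdots<i_k}x_{i_1}^{\alpha_1}\cdots x_{i_k}^{\alpha_k}$ is a well-defined formal power series (each monomial occurs only finitely often) and $Z(\alpha;\alpha+\delta)=M_\alpha$. 2. If $\alpha_k=0$, then for every $\beta\in\mathbb{P}^k$, $$Z(\alpha;\alpha+\delta)=\frac{1}{|\mathfrak{S}_\alpha|}\,Z(\alpha;\beta)^{\mathfrak{S}_\alpha}.$$ 3. If $\alpha_k>0$, then for every $s\ge0$ and $\beta\in\mathbb{P}^k$, $$Z(\alpha,0^s;\ \beta,\delta^s)=Z(\alpha,0^s;\ \delta^{k+s}).$$ 4. $Z(\alpha;\alpha+\delta)=Z(\alpha;\delta^k)$, and this element does not depend on $\delta$; hence the renormalized monomial quasisymmetric function $M_\alpha:=Z(\alpha;\delta^k)$ is well defined for every weak composition $\alpha$. -/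

import Mathlib

open scoped BigOperators

noncomputable section

namespace RenQSym

/-- A letter `(a, b)` with `a ∈ ℕ` (the exponent) and `b ∈ ℙ` (the direction).  Lists of letters are
the directional weak compositions `(α; β)`, the basis of the quasi-shuffle Hopf algebra on
`ℕ × ℙ` with deconcatenation coproduct. -/
abbrev Letter : Type := ℕ × ℕ+

/-- Formal power series in the variables `x_i`, `i ∈ ℙ`. -/
abbrev PowX (R : Type*) : Type _ := MvPowerSeries ℕ+ R

/-- The ring `R[[X]][t]`. -/
abbrev PolyT (R : Type*) [CommRing R] : Type _ := Polynomial (PowX R)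

/-- The exponent of the monomial `x_{i_1}^{α_1} ⋯ x_{i_k}^{α_k}`, for `i_1 < ⋯ < i_k` in `ℙ`. -/
def monomialExp {k : ℕ} (α : Fin k → ℕ) (I : Fin k ↪o ℕ+) : ℕ+ →₀ ℕ :=
  ∑ j, Finsupp.single (I j) (α j)

/-- The strictly increasing sequences `I` of indices with `x_I^α = x^m`. -/
def indexSet {k : ℕ} (α : Fin k → ℕ) (m : ℕ+ →₀ ℕ) : Set (Fin k ↪o ℕ+) :=
  {I | monomialExp α I = m}

/-- The monomial series `M_α = ∑_{i_1 < ⋯ < i_k} x_{i_1}^{α_1} ⋯ x_{i_k}^{α_k}`: the coefficient of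
`x^m` is the number of `I` with `x_I^α = x^m`.  (Meaningful when all these numbers are finite.) -/
def monomialQSym (R : Type*) [CommRing R] {k : ℕ} (α : Fin k → ℕ) : PowX R :=
  fun m => ((indexSet α m).ncard : R)

/-! ### Regularization -/

/-- The weight `e^{(i_1+t) β_1 z} ⋯ e^{(i_k+t) β_k z}` carried by `x_I^α`. -/
def regWeight {k : ℕ} (β : Fin k → ℕ+) (t : ℝ) (z : ℂ) (I : Fin k ↪o ℕ+) : ℂ :=
  ∏ j, Complex.exp ((((I j : ℕ) : ℂ) + (t : ℂ)) * ((β j : ℕ) : ℂ) * z)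

/-- For `Φ ∈ ℚ[[X]][t][z⁻¹, z]]`, the value at `t` of the coefficient of `x^m z^n`, which is a
polynomial in `t`. -/
def coeffAt (Φ : LaurentSeries (PolyT ℚ)) (m : ℕ+ →₀ ℕ) (n : ℤ) (t : ℝ) : ℂ :=
  (Φ.coeff n).sum fun s g => ((MvPowerSeries.coeff m g : ℚ) : ℂ) * (t : ℂ) ^ s

/-- `Φ ∈ ℚ[[X]][t][z⁻¹, z]]` is the expansion of
`∑_{i_1 < ⋯ < i_k} x_{i_1}^{α_1} ⋯ x_{i_k}^{α_k} e^{(i_1+t) β_1 z} ⋯ e^{(i_k+t) β_k z}`: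
for all `t ≥ 0` the coefficient of every monomial `x^m` converges absolutely for `Re z < 0`, and its
Laurent series expansion near `z = 0` is given by the coefficients of `Φ`. -/
def IsRegularization {k : ℕ} (α : Fin k → ℕ) (β : Fin k → ℕ+) (Φ : LaurentSeries (PolyT ℚ)) : Prop :=
  ∀ (m : ℕ+ →₀ ℕ) (t : ℝ), 0 ≤ t →
    (∀ z : ℂ, z.re < 0 → Summable fun I : indexSet α m => regWeight β t z I) ∧
    ∃ ε : ℝ, 0 < ε ∧ ∀ z : ℂ, z.re < 0 → ‖z‖ < ε →
      HasSum (fun n : ℤ => coeffAt Φ m n t * z ^ n) (∑' I : indexSet α m, regWeight β t z I)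

open Classical in
/-- The regularization `φ(α; β) ∈ ℚ[[X]][t][z⁻¹, z]]`. -/
def regularization (w : List Letter) : LaurentSeries (PolyT ℚ) :=
  if h : ∃ Φ, IsRegularization (fun j => (w.get j).1) (fun j => (w.get j).2) Φ then h.choose else 0

/-- The regularization with scalars extended from `ℚ` to `R`. -/
def phi (R : Type*) [CommRing R] [Algebra ℚ R] (w : List Letter) : LaurentSeries (PolyT R) :=
  (regularization w).map (Polynomial.mapRingHom (MvPowerSeries.map (σ := ℕ+) (algebraMap ℚ R)))

/-! ### Algebraic Birkhoff Factorization -/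

/-- The projection of a Laurent series onto its polar part. -/
def polarPart {A : Type*} [Zero A] (f : LaurentSeries A) : LaurentSeries A :=
  HahnSeries.truncLT 0 f

/-- The factor `φ₋` of the Algebraic Birkhoff Factorization `φ = φ₊ ⋆ φ₋^{⋆(-1)}` with respect to the
deconcatenation coproduct: `φ₋(∅) = 1` and
`φ₋(w) = -P(φ(w) + ∑_{0 < i < k} φ(w_1 ⋯ w_i) φ₋(w_{i+1} ⋯ w_k))`. -/
def phiMinus (R : Type*) [CommRing R] [Algebra ℚ R] : List Letter → LaurentSeries (PolyT R)
  | [] => 1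
  | a :: l =>
      - polarPart (phi R (a :: l) +
        ∑ i : Fin l.length, phi R ((a :: l).take (i + 1)) * phiMinus R ((a :: l).drop (i + 1)))
  termination_by w => w.length
  decreasing_by simp

/-- The renormalized factor `φ₊`: `φ₊(∅) = 1` and
`φ₊(w) = (id - P)(φ(w) + ∑_{0 < i < k} φ(w_1 ⋯ w_i) φ₋(w_{i+1} ⋯ w_k))`. -/
def phiPlus (R : Type*) [CommRing R] [Algebra ℚ R] : List Letter → LaurentSeries (PolyT R)
  | [] => 1
  | a :: l =>
      let f := phi R (a :: l) +
        ∑ i : Fin l.length, phi R ((a :: l).take (i + 1)) * phiMinus R ((a :: l).drop (i + 1))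
      f - polarPart f

/-- The directional quasisymmetric function `Z(α; β) = φ₊(α; β)|_{z = 0} ∈ R[[X]][t]`. -/
def Z (R : Type*) [CommRing R] [Algebra ℚ R] {k : ℕ} (α : Fin k → ℕ) (β : Fin k → ℕ+) : PolyT R :=
  (phiPlus R (List.ofFn fun j => (α j, β j))).coeff 0

/-! ### Symmetrization -/

/-- The permutation group of the positions `j + 1, …, k` of the trailing zeros of `α`, realized as
the permutations of all positions that fix each position at or before the last positive component. -/
def trailingPerms {k : ℕ} (α : Fin k → ℕ) : Finset (Equiv.Perm (Fin k)) :=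
  Finset.univ.filter fun σ => ∀ i, (∃ i', i ≤ i' ∧ 0 < α i') → σ i = i

/-- The sum of `Z` over all permutations of the directions at the trailing zeros of `α`. -/
def symZ (R : Type*) [CommRing R] [Algebra ℚ R] {k : ℕ} (α : Fin k → ℕ) (β : Fin k → ℕ+) : PolyT R :=
  ∑ σ ∈ trailingPerms α, Z R α fun i => β (σ i)

/-- The direction `α + δ = (α_1 + δ, …, α_k + δ)`. -/
def addDir {k : ℕ} (α : Fin k → ℕ) (δ : ℕ+) : Fin k → ℕ+ :=
  fun i => ⟨α i + δ, Nat.add_pos_right _ δ.pos⟩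

end RenQSym

end

/-!
Polynomials in `t` over `ℚ[[X]]` are determined by their values at `t = q ∈ ℕ`, and everything is
defined over `ℚ`, so the proof takes place at a natural number `t = q`, coefficient by coefficient
in the monomials `x^m`, and is transported to `R` at the end (`Z_eq_map`).

Write a composition as `u` followed by `s` zeros, where `u` is empty or ends with a positive entry.
A monomial `x^m` leaves finitely many choices for the indices `I` at the positions of `u`
(`indexSet_finite`), while the indices at the zeros run freely above the last entry `n_I` of `I`.
With `x = e^z`, the latter contribute the nested geometric sum over `c < j_1 < ⋯ < j_s` for
`c = q + n_I`, whose closed form is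
`T_c(b_1 ⋯ b_s) = x^(c(b_1 + ⋯ + b_s)) ∏ i, g(b_i + ⋯ + b_s)` with `g(B) = x^B / (1 - x^B)`
(`tailSum`, `hasSum_tailSum`). This identity between functions on a half disc becomes an identity of
Laurent series since expansions are unique and compatible with products and inverses (`Rep.unique`,
`Rep.mul`, `Rep.inv`); it also yields existence and uniqueness of the regularization.

Let `m_q` be the polar factor of `T_q`. The relation `g(A + B)(1 + g(A) + g(B)) = g(A) g(B)` says
that `T_c` respects the quasi-shuffle product with a letter (`qsh_tailSum`). So does `m_q`, because
the defect is both polar and regular (`birkhoffMinus_qsh`), and hence so does `ψ_c = T_c ⋆ m_q`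
(`psi`). Removing the index `c + 1` shows that `ψ_c` has no pole for any `c ≥ q` (`isReg_psi`).
Consequently the polar factor vanishes on words with a positive exponent
(`birkhoffMinus_phiEval_eq_zero`), and the coefficient of `x^m` in `Z` at `t = q` is `∑_I χ(b)`,
where `χ` is the value of `ψ_{q + n_I}` at `z = 0` (`coeffEval_Z`). In particular it depends on the
directions `b` at the trailing zeros only, and it is the number of the sequences `I` if there are no
trailing zeros.

Finally, `χ([b])` is a constant `κ` that does not depend on `b`, since replacing `b` amounts to
rescaling `z` (`chi_singleton`). The quasi-shuffle relation then gives by induction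
`∑_σ χ(b_σ) = κ (κ - 1) ⋯ (κ - s + 1)` for every `b` (`sum_perm_chi`). Hence the symmetrization does
not depend on the directions, and neither does the value for constant directions.
-/

namespace RenQSym

/-! ### Laurent series: change of coefficients, regular series and polar series -/

section Laurent

variable {A B : Type*} [CommRing A] [CommRing B]

/-- The ring homomorphism between rings of Laurent series that applies `ρ` to every coefficient. -/
noncomputable def laurentMap (ρ : A →+* B) : LaurentSeries A →+* LaurentSeries B where
  toFun f := f.map ρ
  map_one' := HahnSeries.map_one ρ.toMonoidWithZeroHom
  map_mul' _ _ := HahnSeries.map_mul (ρ : A →ₙ+* B)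
  map_zero' := HahnSeries.map_zero (ρ : ZeroHom A B)
  map_add' _ _ := HahnSeries.map_add (ρ : A →+ B)

@[simp] lemma coeff_laurentMap (ρ : A →+* B) (f : LaurentSeries A) (n : ℤ) :
    (laurentMap ρ f).coeff n = ρ (f.coeff n) := rfl

lemma laurentMap_injective {ρ : A →+* B} (hρ : Function.Injective ρ) :
    Function.Injective (laurentMap ρ) := fun f g h => by
  ext n
  exact hρ (by simpa using congrArg (fun x => HahnSeries.coeff x n) h)

/-- The additive map between groups of Laurent series that applies `c` to every coefficient. -/
noncomputable def laurentMapAdd (c : A →+ B) : LaurentSeries A →+ LaurentSeries B where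
  toFun f := f.map c
  map_zero' := HahnSeries.map_zero (c : ZeroHom A B)
  map_add' _ _ := HahnSeries.map_add c

@[simp] lemma coeff_laurentMapAdd (c : A →+ B) (f : LaurentSeries A) (n : ℤ) :
    (laurentMapAdd c f).coeff n = c (f.coeff n) := rfl

/-- The extraction `c` is linear over the series with coefficients in the image of `ρ`. -/
lemma laurentMapAdd_mul (c : A →+ B) (ρ : B →+* A) (h : ∀ a b, c (a * ρ b) = c a * b)
    (f : LaurentSeries A) (g : LaurentSeries B) :
    laurentMapAdd c (f * laurentMap ρ g) = laurentMapAdd c f * g := by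
  ext n
  have hf : (laurentMapAdd c f).support ⊆ f.support := fun i hi hi' => hi (by simp [hi'])
  have hg : (laurentMap ρ g).support ⊆ g.support := fun i hi hi' => hi (by simp [hi'])
  rw [coeff_laurentMapAdd, HahnSeries.coeff_mul_right' g.isPWO_support hg,
    HahnSeries.coeff_mul_left' f.isPWO_support hf, map_sum]
  simp [h]

/-- A Laurent series without polar part. -/
def IsReg (f : LaurentSeries A) : Prop := ∀ n < 0, f.coeff n = 0

/-- A Laurent series that equals its polar part. -/
def IsPolar (f : LaurentSeries A) : Prop := ∀ n, 0 ≤ n → f.coeff n = 0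

lemma IsReg.zero : IsReg (0 : LaurentSeries A) := fun _ _ => rfl

lemma IsReg.add {f g : LaurentSeries A} (hf : IsReg f) (hg : IsReg g) : IsReg (f + g) :=
  fun n hn => by simp [hf n hn, hg n hn]

lemma IsReg.sub {f g : LaurentSeries A} (hf : IsReg f) (hg : IsReg g) : IsReg (f - g) :=
  fun n hn => by simp [hf n hn, hg n hn]

lemma IsReg.sum {ι : Type*} (s : Finset ι) {f : ι → LaurentSeries A} (h : ∀ i ∈ s, IsReg (f i)) :
    IsReg (∑ i ∈ s, f i) := by
  classical
  induction s using Finset.induction_on with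
  | empty => exact IsReg.zero
  | insert a s ha ih =>
    rw [Finset.sum_insert ha]
    exact (h a (by simp)).add (ih fun i hi => h i (by simp [hi]))

lemma isReg_ofPowerSeries (p : PowerSeries A) : IsReg (HahnSeries.ofPowerSeries ℤ A p) :=
  fun n hn => by
    rw [PowerSeries.coeff_coe, if_pos hn]

lemma coeff_zero_ofPowerSeries (p : PowerSeries A) :
    (HahnSeries.ofPowerSeries ℤ A p).coeff 0 = PowerSeries.constantCoeff p := by
  rw [PowerSeries.coeff_coe]
  simp

lemma IsReg.exists_powerSeries {f : LaurentSeries A} (hf : IsReg f) :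
    ∃ p, f = HahnSeries.ofPowerSeries ℤ A p := by
  refine ⟨PowerSeries.mk fun n => f.coeff n, ?_⟩
  ext n
  rw [PowerSeries.coeff_coe]
  split_ifs with h
  · exact hf n h
  · simp [Int.natAbs_of_nonneg (not_lt.1 h)]

lemma IsReg.one : IsReg (1 : LaurentSeries A) := by
  simpa using isReg_ofPowerSeries (1 : PowerSeries A)

lemma IsReg.mul {f g : LaurentSeries A} (hf : IsReg f) (hg : IsReg g) : IsReg (f * g) := by
  obtain ⟨p, rfl⟩ := hf.exists_powerSeries
  obtain ⟨q, rfl⟩ := hg.exists_powerSeries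
  rw [← map_mul]
  exact isReg_ofPowerSeries _

lemma IsReg.coeff_zero_mul {f g : LaurentSeries A} (hf : IsReg f) (hg : IsReg g) :
    (f * g).coeff 0 = f.coeff 0 * g.coeff 0 := by
  obtain ⟨p, rfl⟩ := hf.exists_powerSeries
  obtain ⟨q, rfl⟩ := hg.exists_powerSeries
  rw [← map_mul, coeff_zero_ofPowerSeries, coeff_zero_ofPowerSeries, coeff_zero_ofPowerSeries,
    map_mul]

lemma IsPolar.sub {f g : LaurentSeries A} (hf : IsPolar f) (hg : IsPolar g) : IsPolar (f - g) :=
  fun n hn => by simp [hf n hn, hg n hn]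

lemma IsPolar.add {f g : LaurentSeries A} (hf : IsPolar f) (hg : IsPolar g) : IsPolar (f + g) :=
  fun n hn => by simp [hf n hn, hg n hn]

lemma IsPolar.mul {f g : LaurentSeries A} (hf : IsPolar f) (hg : IsPolar g) : IsPolar (f * g) := by
  intro n hn
  rw [HahnSeries.coeff_mul]
  refine Finset.sum_eq_zero fun ij hij => ?_
  rw [Finset.mem_antidiagonal] at hij
  rcases le_or_gt 0 ij.1 with h | h
  · rw [hf _ h, zero_mul]
  · rw [hg _ (by omega), mul_zero]

lemma IsReg.eq_zero_of_isPolar {f : LaurentSeries A} (hf : IsReg f) (hp : IsPolar f) : f = 0 := by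
  ext n
  rcases le_or_gt 0 n with h | h
  · exact hp n h
  · exact hf n h

lemma coeff_polarPart (f : LaurentSeries A) (n : ℤ) :
    (polarPart f).coeff n = if n < 0 then f.coeff n else 0 := by
  rw [polarPart, HahnSeries.coeff_truncLT]

lemma isPolar_neg_polarPart (f : LaurentSeries A) : IsPolar (-polarPart f) := fun n hn => by
  simp [coeff_polarPart, not_lt.2 hn]

lemma isReg_sub_polarPart (f : LaurentSeries A) : IsReg (f - polarPart f) := fun n hn => by
  simp [coeff_polarPart, hn]

lemma IsReg.polarPart_eq_zero {f : LaurentSeries A} (hf : IsReg f) : polarPart f = 0 := by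
  ext n
  rw [coeff_polarPart]
  split_ifs with h
  · exact hf n h
  · rfl

lemma polarPart_laurentMap (ρ : A →+* B) (f : LaurentSeries A) :
    polarPart (laurentMap ρ f) = laurentMap ρ (polarPart f) := by
  ext n
  simp only [coeff_polarPart, coeff_laurentMap]
  split_ifs <;> simp

end Laurent

/-! ### Deconcatenation and the quasi-shuffle product with a letter -/

section Words

variable {L : Type*} {S : Type*} [CommRing S]

/-- The convolution `∑_{w = w' w''} f(w') g(w'')` of two functions on words with respect to the
deconcatenation coproduct, computed by recursion on the word. -/
def conv (f g : List L → S) : List L → S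
  | [] => f [] * g []
  | x :: w => f [] * g (x :: w) + conv (fun v => f (x :: v)) g w

lemma conv_eq_sum (g : List L → S) : ∀ (w : List L) (f : List L → S),
    conv f g w = ∑ i ∈ Finset.range (w.length + 1), f (w.take i) * g (w.drop i)
  | [], f => by simp [conv]
  | x :: w, f => by
    rw [conv, conv_eq_sum g w, List.length_cons, Finset.sum_range_succ' _ (w.length + 1), add_comm]
    simp

lemma conv_add_left (f f' g : List L → S) (w : List L) :
    conv (fun v => f v + f' v) g w = conv f g w + conv f' g w := by
  simp only [conv_eq_sum, add_mul, Finset.sum_add_distrib]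

lemma conv_sub_left (f f' g : List L → S) (w : List L) :
    conv (fun v => f v - f' v) g w = conv f g w - conv f' g w := by
  simp only [conv_eq_sum, sub_mul, Finset.sum_sub_distrib]

lemma conv_const_mul_left (c : S) (f g : List L → S) (w : List L) :
    conv (fun v => c * f v) g w = c * conv f g w := by
  simp only [conv_eq_sum, Finset.mul_sum, mul_assoc]

lemma conv_const_mul_right (c : S) (f g : List L → S) (w : List L) :
    conv f (fun v => c * g v) w = c * conv f g w := by
  simp only [conv_eq_sum, Finset.mul_sum, mul_left_comm]

/-- If `g` vanishes on all words `u'' v` with `u''` a nonempty proper suffix of `u`, then only the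
deconcatenations inside `v` contribute. -/
lemma conv_append (g : List L → S) (v : List L) : ∀ (u : List L) (f : List L → S),
    (∀ u', u' ≠ [] → u' <:+ u → g (u' ++ v) = 0) →
    conv f g (u ++ v) = conv (fun w => f (u ++ w)) g v
  | [], _, _ => rfl
  | x :: u, f, h => by
    rw [List.cons_append, conv, ← List.cons_append, h (x :: u) (by simp) List.suffix_rfl, mul_zero,
      zero_add, conv_append g v u _ fun u' hu' hs => h u' hu' (hs.trans (List.suffix_cons x u))]
    rfl

variable [Add L]

/-- The value of (the linear extension of) `f` on the quasi-shuffle product of the one-letter word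
`a` with the word `w`: the letter `a` is inserted at some position of `w` or added to one of the
letters of `w`. -/
def qsh (f : List L → S) (a : L) : List L → S
  | [] => f [a]
  | x :: w => f (a :: x :: w) + f ((a + x) :: w) + qsh (fun v => f (x :: v)) a w

lemma qsh_add (a : L) : ∀ (w : List L) (f g : List L → S),
    qsh (fun v => f v + g v) a w = qsh f a w + qsh g a w
  | [], _, _ => rfl
  | x :: w, f, g => by simp only [qsh, qsh_add a w]; ring

lemma qsh_const_mul (a : L) (c : S) : ∀ (w : List L) (f : List L → S),
    qsh (fun v => c * f v) a w = c * qsh f a w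
  | [], _ => rfl
  | x :: w, f => by simp only [qsh, qsh_const_mul a c w]; ring

/-- Deconcatenation is compatible with the quasi-shuffle product, and a letter is primitive. -/
lemma qsh_conv (g : List L → S) (a : L) : ∀ (w : List L) (f : List L → S),
    qsh (conv f g) a w = conv (qsh f a) g w + conv f (qsh g a) w
  | [], f => by simp [qsh, conv]; ring
  | x :: w, f => by
    have h : qsh (fun v => conv f g (x :: v)) a w =
        f [] * qsh (fun v => g (x :: v)) a w +
          (conv (qsh (fun v => f (x :: v)) a) g w + conv (fun v => f (x :: v)) (qsh g a) w) := by
      simp only [conv]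
      rw [qsh_add, qsh_const_mul, ← qsh_conv g a w]
    simp only [qsh, h]
    simp only [conv, qsh, conv_add_left]
    ring

end Words

/-! ### Algebraic Birkhoff Factorization over a general alphabet -/

section Birkhoff

variable {L : Type*} {A B : Type*} [CommRing A] [CommRing B]

/-- The polar factor of the Algebraic Birkhoff Factorization of a function `φ` on words with values
in Laurent series. -/
noncomputable def birkhoffMinus (φ : List L → LaurentSeries A) : List L → LaurentSeries A
  | [] => 1
  | a :: l =>
      - polarPart (φ (a :: l) +
        ∑ i : Fin l.length, φ ((a :: l).take (i + 1)) * birkhoffMinus φ ((a :: l).drop (i + 1)))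
  termination_by w => w.length
  decreasing_by simp

/-- The convolution `φ ⋆ φ₋`, whose values are the regular factor. -/
noncomputable def birkhoffPlus (φ : List L → LaurentSeries A) : List L → LaurentSeries A :=
  conv φ (birkhoffMinus φ)

@[simp] lemma birkhoffMinus_nil (φ : List L → LaurentSeries A) : birkhoffMinus φ [] = 1 := by
  rw [birkhoffMinus]

lemma add_sum_eq_conv (φ : List L → LaurentSeries A) (a : L) (l : List L) :
    φ (a :: l) +
        ∑ i : Fin l.length, φ ((a :: l).take (i + 1)) * birkhoffMinus φ ((a :: l).drop (i + 1)) =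
      conv (fun w => φ (a :: w)) (birkhoffMinus φ) l := by
  rw [conv_eq_sum, Finset.sum_range_succ, add_comm, Finset.sum_range]
  simp

lemma birkhoffMinus_cons (φ : List L → LaurentSeries A) (a : L) (l : List L) :
    birkhoffMinus φ (a :: l) = - polarPart (conv (fun w => φ (a :: w)) (birkhoffMinus φ) l) := by
  rw [birkhoffMinus, add_sum_eq_conv]

lemma birkhoffPlus_cons (φ : List L → LaurentSeries A) (h : φ [] = 1) (a : L) (l : List L) :
    birkhoffPlus φ (a :: l) = conv (fun w => φ (a :: w)) (birkhoffMinus φ) l -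
      polarPart (conv (fun w => φ (a :: w)) (birkhoffMinus φ) l) := by
  rw [birkhoffPlus, conv, h, one_mul, birkhoffMinus_cons]
  ring

lemma isPolar_birkhoffMinus (φ : List L → LaurentSeries A) {w : List L} (hw : w ≠ []) :
    IsPolar (birkhoffMinus φ w) := by
  cases w with
  | nil => exact absurd rfl hw
  | cons a l => rw [birkhoffMinus_cons]; exact isPolar_neg_polarPart _

lemma isReg_birkhoffPlus (φ : List L → LaurentSeries A) (h : φ [] = 1) (w : List L) :
    IsReg (birkhoffPlus φ w) := by
  cases w with
  | nil => simpa [birkhoffPlus, conv, h] using IsReg.one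
  | cons a l => rw [birkhoffPlus_cons φ h]; exact isReg_sub_polarPart _

/-- The factorization is natural in the alphabet and in the coefficients. -/
lemma birkhoffMinus_map {L' : Type*} (ρ : A →+* B) (f : L' → L) (φ : List L' → LaurentSeries A)
    (ψ : List L → LaurentSeries B) (h : ∀ w, ψ (w.map f) = laurentMap ρ (φ w)) (w : List L') :
    birkhoffMinus ψ (w.map f) = laurentMap ρ (birkhoffMinus φ w) := by
  induction hn : w.length using Nat.strong_induction_on generalizing w with
  | _ n ih =>
    cases w with
    | nil => simp
    | cons a l =>
      rw [List.map_cons, birkhoffMinus_cons, birkhoffMinus_cons, map_neg, ← polarPart_laurentMap]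
      congr 2
      simp only [conv_eq_sum, map_sum, map_mul, List.length_map]
      refine Finset.sum_congr rfl fun i _ => ?_
      rw [← List.map_drop, ih (l.drop i).length (by simp at hn ⊢; omega) (l.drop i) rfl,
        ← List.map_take, ← List.map_cons, h]

/-- If `φ` respects the quasi-shuffle product with a letter, then so does `φ₋`: the defect is at the
same time a polar and a regular series. -/
lemma birkhoffMinus_qsh [Add L] (φ : List L → LaurentSeries A) (h1 : φ [] = 1)
    (hφ : ∀ a w, qsh φ a w = φ [a] * φ w) (a : L) (w : List L) :
    qsh (birkhoffMinus φ) a w = birkhoffMinus φ [a] * birkhoffMinus φ w := by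
  induction hn : w.length using Nat.strong_induction_on generalizing w with
  | _ n ih =>
    cases w with
    | nil => simp [qsh]
    | cons x l =>
      set m := birkhoffMinus φ with hm
      -- Only the trivial deconcatenation contributes to the convolution with the defect of `φ₋`.
      have hdef : conv φ (fun v => qsh m a v - m [a] * m v) (x :: l) =
          qsh m a (x :: l) - m [a] * m (x :: l) := by
        rw [conv, h1, one_mul, conv_eq_sum, Finset.sum_eq_zero, add_zero]
        intro i _
        rw [ih (l.drop i).length (by simp at hn ⊢; omega) (l.drop i) rfl, sub_self, mul_zero]
      have hplus : qsh (birkhoffPlus φ) a (x :: l) - birkhoffPlus φ [a] * birkhoffPlus φ (x :: l) =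
          qsh m a (x :: l) - m [a] * m (x :: l) := by
        rw [← hdef, birkhoffPlus, ← hm, qsh_conv]
        have e1 : conv (qsh φ a) m (x :: l) = φ [a] * conv φ m (x :: l) := by
          rw [← conv_const_mul_left]
          congr 1
          funext v
          exact hφ a v
        have e2 : conv φ m [a] = m [a] + φ [a] := by simp [conv, h1, hm]
        have e3 : conv φ (fun v => qsh m a v - m [a] * m v) (x :: l) =
            conv φ (qsh m a) (x :: l) - m [a] * conv φ m (x :: l) := by
          rw [← conv_const_mul_right]
          simp only [conv_eq_sum, mul_sub, Finset.sum_sub_distrib]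
        rw [e1, e2, e3]
        ring
      have hreg : IsReg (qsh m a (x :: l) - m [a] * m (x :: l)) := by
        rw [← hplus]
        refine IsReg.sub ?_ ((isReg_birkhoffPlus φ h1 _).mul (isReg_birkhoffPlus φ h1 _))
        have : ∀ (v : List L) (f : List L → LaurentSeries A), (∀ u, IsReg (f u)) →
            IsReg (qsh f a v) := by
          intro v
          induction v with
          | nil => exact fun f hf => hf _
          | cons y v ihv => exact fun f hf => ((hf _).add (hf _)).add (ihv _ fun u => hf _)
        exact this _ _ fun u => isReg_birkhoffPlus φ h1 u
      have hpol : IsPolar (qsh m a (x :: l) - m [a] * m (x :: l)) := by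
        refine IsPolar.sub ?_ ((isPolar_birkhoffMinus φ (by simp)).mul
          (isPolar_birkhoffMinus φ (by simp)))
        have : ∀ (v : List L) (f : List L → LaurentSeries A), (∀ u, u ≠ [] → IsPolar (f u)) →
            IsPolar (qsh f a v) := by
          intro v
          induction v with
          | nil => exact fun f hf => hf _ (by simp)
          | cons y v ihv =>
            exact fun f hf => ((hf _ (by simp)).add (hf _ (by simp))).add
              (ihv _ fun u _ => hf _ (by simp))
        exact this _ _ fun u hu => isPolar_birkhoffMinus φ hu
      exact sub_eq_zero.1 (hreg.eq_zero_of_isPolar hpol)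

/-- The convolution of a quasi-shuffle character with `φ₋` is again a quasi-shuffle character. -/
lemma qsh_conv_birkhoffMinus [Add L] (φ T : List L → LaurentSeries A) (h1 : φ [] = 1)
    (hφ : ∀ a w, qsh φ a w = φ [a] * φ w) (hT1 : T [] = 1) (hT : ∀ a w, qsh T a w = T [a] * T w)
    (a : L) (w : List L) :
    qsh (conv T (birkhoffMinus φ)) a w =
      conv T (birkhoffMinus φ) [a] * conv T (birkhoffMinus φ) w := by
  rw [qsh_conv]
  have e1 : qsh T a = fun v => T [a] * T v := funext (hT a)
  have e2 : qsh (birkhoffMinus φ) a = fun v => birkhoffMinus φ [a] * birkhoffMinus φ v :=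
    funext (birkhoffMinus_qsh φ h1 hφ a)
  rw [e1, e2, conv_const_mul_left, conv_const_mul_right]
  simp [conv, hT1]
  ring

lemma phiMinus_eq (R : Type*) [CommRing R] [Algebra ℚ R] (w : List Letter) :
    phiMinus R w = birkhoffMinus (phi R) w := by
  induction hn : w.length using Nat.strong_induction_on generalizing w with
  | _ n ih =>
    cases w with
    | nil => rw [phiMinus, birkhoffMinus_nil]
    | cons a l =>
      rw [phiMinus, birkhoffMinus]
      congr 3
      refine Finset.sum_congr rfl fun i _ => ?_
      rw [ih ((a :: l).drop (i + 1)).length (by simp at hn ⊢; omega) _ rfl]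

end Birkhoff

/-! ### Nested geometric sums -/

section TailSum

variable {F : Type*} [Field F]

/-- The total weight of a word of directions. -/
def weight (v : List ℕ+) : ℕ := (v.map fun b => (b : ℕ)).sum

@[simp] lemma weight_nil : weight [] = 0 := rfl

@[simp] lemma weight_cons (a : ℕ+) (v : List ℕ+) : weight (a :: v) = a + weight v := by
  simp [weight]

/-- The product of the geometric factors `x^B / (1 - x^B)`, where `B` runs through the weights of
the nonempty suffixes of the word. -/
def tailProd (x : F) : List ℕ+ → F
  | [] => 1
  | a :: v => x ^ (a + weight v) / (1 - x ^ (a + weight v)) * tailProd x v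

/-- The closed form of `∑_{n < j_1 < ⋯ < j_s} x^{j_1 b_1} ⋯ x^{j_s b_s}`. -/
def tailSum (x : F) (n : ℕ) (v : List ℕ+) : F := x ^ (n * weight v) * tailProd x v

@[simp] lemma tailSum_nil (x : F) (n : ℕ) : tailSum x n [] = 1 := by simp [tailSum, tailProd]

/-- Splitting off the terms with `j_1 = n + 1`. -/
lemma tailSum_succ {x : F} (hx : ∀ b : ℕ, 0 < b → x ^ b ≠ 1) (n : ℕ) (a : ℕ+) (v : List ℕ+) :
    tailSum x (n + 1) (a :: v) =
      tailSum x n (a :: v) - x ^ ((n + 1) * a : ℕ) * tailSum x (n + 1) v := by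
  have h : 1 - x ^ (a + weight v : ℕ) ≠ 0 :=
    sub_ne_zero.2 (hx _ (Nat.add_pos_left a.pos _)).symm
  simp only [tailSum, tailProd, weight_cons]
  field_simp
  ring

/-- Multiplying a function by a function of the weight commutes with the quasi-shuffle product. -/
lemma qsh_weight_mul (a : ℕ+) : ∀ (w : List ℕ+) (h : ℕ → F) (f : List ℕ+ → F),
    qsh (fun v => h (weight v) * f v) a w = h (a + weight w) * qsh f a w
  | [], h, f => by simp [qsh]
  | y :: w, h, f => by
    have := qsh_weight_mul a w (fun n => h (y + n)) fun v => f (y :: v)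
    simp only [qsh, weight_cons, this, PNat.add_coe]
    rw [add_left_comm (a : ℕ) y, add_comm (a : ℕ) y, ← add_assoc (y : ℕ) a]
    ring

/-- The geometric factors satisfy `g(A + B) (1 + g(A) + g(B)) = g(A) g(B)`, which is the
quasi-shuffle relation. -/
lemma qsh_tailProd {x : F} (hx : ∀ b : ℕ, 0 < b → x ^ b ≠ 1) (a : ℕ+) : ∀ w : List ℕ+,
    qsh (tailProd x) a w = tailProd x [a] * tailProd x w
  | [] => by simp [qsh, tailProd]
  | y :: w => by
    have h1 : 1 - x ^ (a : ℕ) ≠ 0 := sub_ne_zero.2 (hx _ a.pos).symm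
    have h2 : 1 - x ^ (y + weight w : ℕ) ≠ 0 :=
      sub_ne_zero.2 (hx _ (Nat.add_pos_left y.pos _)).symm
    have h3 : 1 - x ^ (a + (y + weight w) : ℕ) ≠ 0 :=
      sub_ne_zero.2 (hx _ (Nat.add_pos_left a.pos _)).symm
    have h4 : qsh (fun v => tailProd x (y :: v)) a w =
        x ^ (a + (y + weight w) : ℕ) / (1 - x ^ (a + (y + weight w) : ℕ)) *
          (tailProd x [a] * tailProd x w) := by
      rw [← qsh_tailProd hx a w, add_left_comm]
      exact qsh_weight_mul a w (fun n => x ^ (y + n : ℕ) / (1 - x ^ (y + n : ℕ))) _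
    rw [qsh, h4]
    simp only [tailProd, weight_cons, weight_nil, PNat.add_coe, add_zero, mul_one, add_assoc]
    rw [pow_add x a] at h3 ⊢
    field_simp
    ring

lemma qsh_tailSum {x : F} (hx : ∀ b : ℕ, 0 < b → x ^ b ≠ 1) (n : ℕ) (a : ℕ+) (w : List ℕ+) :
    qsh (tailSum x n) a w = tailSum x n [a] * tailSum x n w := by
  have := qsh_weight_mul a w (fun k => x ^ (n * k)) (tailProd x)
  rw [show tailSum x n = fun v => x ^ (n * weight v) * tailProd x v from rfl, this,
    qsh_tailProd hx]
  simp only [weight_cons, weight_nil]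
  ring

lemma map_tailProd {F' : Type*} [Field F'] (ρ : F →+* F') (x : F) : ∀ v : List ℕ+,
    ρ (tailProd x v) = tailProd (ρ x) v
  | [] => by simp [tailProd]
  | a :: v => by simp [tailProd, map_tailProd ρ x v]

end TailSum

/-! ### Renormalization of words of zeros -/

/-- The Laurent series of `e^z`. -/
noncomputable def expL (k : Type*) [Field k] [Algebra ℚ k] : LaurentSeries k :=
  HahnSeries.ofPowerSeries ℤ k (PowerSeries.exp k)

section ExpL

variable {k : Type*} [Field k] [Algebra ℚ k]

lemma expL_pow (b : ℕ) : expL k ^ b =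
    HahnSeries.ofPowerSeries ℤ k (PowerSeries.rescale (b : k) (PowerSeries.exp k)) := by
  rw [expL, ← map_pow, PowerSeries.exp_pow_eq_rescale_exp]

lemma isReg_expL_pow (b : ℕ) : IsReg (expL k ^ b) := by
  rw [expL_pow]
  exact isReg_ofPowerSeries _

lemma coeff_zero_expL_pow (b : ℕ) : (expL k ^ b).coeff 0 = 1 := by
  rw [expL_pow, coeff_zero_ofPowerSeries]
  simp [← PowerSeries.coeff_zero_eq_constantCoeff_apply]

lemma expL_pow_ne_one [CharZero k] (b : ℕ) (hb : 0 < b) : expL k ^ b ≠ 1 := by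
  rw [expL_pow, ← map_one (HahnSeries.ofPowerSeries ℤ k)]
  intro h
  have h1 := congrArg (PowerSeries.coeff 1) (HahnSeries.ofPowerSeries_injective h)
  simp [PowerSeries.coeff_exp, PowerSeries.coeff_one] at h1
  omega

/-- The series `1 - e^{bz}` arises from `1 - e^z = z p(z)` by rescaling the variable, and it has a
simple zero at `z = 0`. -/
lemma exists_one_sub_expL_pow [CharZero k] : ∃ p : PowerSeries k,
    PowerSeries.constantCoeff p ≠ 0 ∧ ∀ b : ℕ, 1 - expL k ^ b = HahnSeries.single (1 : ℤ) (b : k) *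
      HahnSeries.ofPowerSeries ℤ k (PowerSeries.rescale (b : k) p) := by
  obtain ⟨p, hp⟩ := PowerSeries.X_dvd_iff.2
    (show PowerSeries.constantCoeff (1 - PowerSeries.exp k) = 0 by simp)
  refine ⟨p, ?_, fun b => ?_⟩
  · have := congrArg (PowerSeries.coeff 1) hp
    rw [show (1 : ℕ) = 0 + 1 from rfl, PowerSeries.coeff_succ_X_mul,
      PowerSeries.coeff_zero_eq_constantCoeff_apply] at this
    rw [← this]
    simp [PowerSeries.coeff_exp, PowerSeries.coeff_one]
  · rw [expL_pow, ← map_one (HahnSeries.ofPowerSeries ℤ k),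
      ← map_one (PowerSeries.rescale (b : k)), ← map_sub, ← map_sub, hp, map_mul, map_mul,
      PowerSeries.rescale_X, map_mul, HahnSeries.ofPowerSeries_C, HahnSeries.ofPowerSeries_X]
    congr 1
    rw [HahnSeries.C_apply, HahnSeries.single_mul_single]
    simp

/-- The series `x^(c+1) / (1 - x)` with `x = e^{az}` arises from the one with `x = e^z` by
rescaling the variable `z`, so that its constant coefficient does not depend on `a`. -/
lemma coeff_zero_tailSum_singleton [CharZero k] (c : ℕ) (a : ℕ+) :
    (tailSum (expL k) c [a]).coeff 0 = (tailSum (expL k) c [1]).coeff 0 := by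
  obtain ⟨p, hp0, hp⟩ := exists_one_sub_expL_pow (k := k)
  have hpi : p * p⁻¹ = 1 := PowerSeries.mul_inv_cancel p hp0
  have key : ∀ b : ℕ+, tailSum (expL k) c [b] = HahnSeries.single (-1 : ℤ) (b : k)⁻¹ *
      HahnSeries.ofPowerSeries ℤ k
        (PowerSeries.rescale (b : k) (PowerSeries.exp k ^ (c + 1) * p⁻¹)) := by
    intro b
    have hb : ((b : ℕ) : k) ≠ 0 := Nat.cast_ne_zero.2 b.ne_zero
    have h1 : (1 : LaurentSeries k) - expL k ^ (b : ℕ) ≠ 0 :=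
      sub_ne_zero.2 (expL_pow_ne_one _ b.pos).symm
    have h3 : tailSum (expL k) c [b] = expL k ^ ((c + 1) * b : ℕ) / (1 - expL k ^ (b : ℕ)) := by
      simp [tailSum, tailProd]
      ring
    rw [h3, div_eq_iff h1, hp, mul_mul_mul_comm, HahnSeries.single_mul_single, ← map_mul,
      ← map_mul, mul_assoc, mul_comm p⁻¹, hpi, mul_one, map_pow, map_pow, inv_mul_cancel₀ hb,
      mul_comm (c + 1), pow_mul, expL_pow]
    simp
  rw [key a, key 1]
  have h4 : ∀ (r : k) (f : LaurentSeries k),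
      (HahnSeries.single (-1 : ℤ) r * f).coeff 0 = r * f.coeff 1 := by
    intro r f
    rw [HahnSeries.coeff_single_mul]
    norm_num
  have ha : ((a : ℕ) : k) ≠ 0 := Nat.cast_ne_zero.2 a.ne_zero
  rw [h4, h4, PowerSeries.coeff_coe, PowerSeries.coeff_coe, if_neg (by simp), if_neg (by simp),
    PowerSeries.coeff_rescale, PowerSeries.coeff_rescale, Int.natAbs_one, pow_one, pow_one,
    inv_mul_cancel_left₀ ha]
  simp

end ExpL

/-- The convolution of the nested sums over indices `> c` with the polar factor of the nested sums
over indices `> q`. -/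
noncomputable def psi (q c : ℕ) : List ℕ+ → LaurentSeries ℚ :=
  conv (tailSum (expL ℚ) c) (birkhoffMinus (tailSum (expL ℚ) q))

/-- Renormalizing the sum over indices `> q + n` with the polar factor for indices `> q` leaves no
pole: removing one index at a time changes the sum by regular series only. -/
lemma isReg_psi (q n : ℕ) (w : List ℕ+) : IsReg (psi q (q + n) w) := by
  induction n generalizing w with
  | zero => exact isReg_birkhoffPlus _ (tailSum_nil _ _) w
  | succ n ih =>
    induction w with
    | nil => simpa [psi, conv] using IsReg.one
    | cons a v ihv =>
      have h : psi q (q + (n + 1)) (a :: v) = psi q (q + n) (a :: v) -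
          expL ℚ ^ ((q + n + 1) * a : ℕ) * psi q (q + (n + 1)) v := by
        have e : (fun v => tailSum (expL ℚ) (q + (n + 1)) (a :: v)) = fun v =>
            tailSum (expL ℚ) (q + n) (a :: v) -
              expL ℚ ^ ((q + n + 1) * a : ℕ) * tailSum (expL ℚ) (q + (n + 1)) v :=
          funext fun v => tailSum_succ expL_pow_ne_one (q + n) a v
        simp only [psi, conv, tailSum_nil, e]
        rw [conv_sub_left, conv_const_mul_left]
        ring
      rw [h]
      exact (ih _).sub ((isReg_expL_pow _).mul ihv)

/-- The renormalized value at `z = 0` of the nested sum over indices `> c`. -/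
noncomputable def chi (q c : ℕ) (w : List ℕ+) : ℚ := (psi q c w).coeff 0

lemma chi_nil (q c : ℕ) : chi q c [] = 1 := by
  simp [chi, psi, conv]

/-- For a single letter the renormalized value does not depend on the direction. -/
lemma chi_singleton (q c : ℕ) (a : ℕ+) : chi q c [a] = chi q c [1] := by
  have h : ∀ b : ℕ+, chi q c [b] = (tailSum (expL ℚ) c [b]).coeff 0 := by
    intro b
    have := isPolar_birkhoffMinus (tailSum (expL ℚ) q) (w := [b]) (by simp) 0 le_rfl
    simp [chi, psi, conv, this]
  rw [h, h, coeff_zero_tailSum_singleton]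

lemma coeff_qsh {F : Type*} [Field F] (n : ℤ) (a : ℕ+) :
    ∀ (w : List ℕ+) (f : List ℕ+ → LaurentSeries F),
      (qsh f a w).coeff n = qsh (fun v => (f v).coeff n) a w
  | [], _ => rfl
  | x :: w, f => by simp only [qsh, HahnSeries.coeff_add, coeff_qsh n a w]

lemma qsh_chi (q n : ℕ) (a : ℕ+) (w : List ℕ+) :
    qsh (chi q (q + n)) a w = chi q (q + n) [1] * chi q (q + n) w := by
  rw [show chi q (q + n) = fun v => (psi q (q + n) v).coeff 0 from rfl, ← coeff_qsh, psi,
    qsh_conv_birkhoffMinus _ _ (tailSum_nil _ _) (qsh_tailSum expL_pow_ne_one q) (tailSum_nil _ _)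
      (qsh_tailSum expL_pow_ne_one (q + n))]
  rw [← psi, (isReg_psi q n _).coeff_zero_mul (isReg_psi q n _)]
  exact congrArg (· * _) (chi_singleton q (q + n) a)

/-! ### Symmetrization over all permutations -/

/-- The quasi-shuffle product with a letter, written as a sum over the positions of the word. -/
lemma qsh_ofFn {L S : Type*} [Add L] [CommRing S] (a : L) : ∀ {s : ℕ} (w : Fin s → L)
    (f : List L → S), qsh f a (List.ofFn w) =
      ∑ p : Fin (s + 1), f (List.ofFn (Fin.insertNth (α := fun _ => L) p a w)) +
        ∑ i : Fin s, f (List.ofFn (Function.update w i (a + w i)))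
  | 0, w, f => by simp [qsh]
  | s + 1, w, f => by
    obtain ⟨x, v, rfl⟩ : ∃ x v, w = Fin.cons x v := ⟨w 0, Fin.tail w, (Fin.cons_self_tail w).symm⟩
    have e1 : ∀ p : Fin (s + 1),
        List.ofFn (Fin.insertNth (α := fun _ => L) p.succ a (Fin.cons x v : Fin (s + 1) → L)) =
          x :: List.ofFn (Fin.insertNth (α := fun _ => L) p a v) := fun p => by
      rw [Fin.insertNth_succ_cons, List.ofFn_cons]
    have e2 : List.ofFn (Fin.insertNth (α := fun _ => L) 0 a (Fin.cons x v : Fin (s + 1) → L)) =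
        a :: x :: List.ofFn v := by
      rw [Fin.insertNth_zero', List.ofFn_cons, List.ofFn_cons]
    have e3 : ∑ i : Fin (s + 1), f (List.ofFn (Function.update (Fin.cons x v : Fin (s + 1) → L) i
          (a + (Fin.cons x v : Fin (s + 1) → L) i))) =
        f ((a + x) :: List.ofFn v) +
          ∑ i : Fin s, f (x :: List.ofFn (Function.update v i (a + v i))) := by
      rw [Fin.sum_univ_succ]
      simp only [List.ofFn_cons, Fin.cons_zero, Fin.update_cons_zero, Fin.cons_succ,
        ← Fin.cons_update]
    rw [e3, Fin.sum_univ_succ, e2, List.ofFn_cons, qsh, qsh_ofFn a v]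
    simp only [e1]
    ring

/-- The permutation of `Fin (s + 1)` that sends `p` to `0` and otherwise acts like `τ`. -/
def insertPerm {s : ℕ} (p : Fin (s + 1)) (τ : Equiv.Perm (Fin s)) : Equiv.Perm (Fin (s + 1)) :=
  (finSuccEquiv' p).trans ((Equiv.optionCongr τ).trans (finSuccEquiv' 0).symm)

lemma insertPerm_self {s : ℕ} (p : Fin (s + 1)) (τ : Equiv.Perm (Fin s)) :
    insertPerm p τ p = 0 := by
  simp [insertPerm]

lemma insertPerm_succAbove {s : ℕ} (p : Fin (s + 1)) (τ : Equiv.Perm (Fin s)) (i : Fin s) :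
    insertPerm p τ (p.succAbove i) = (τ i).succ := by
  simp [insertPerm]

lemma comp_insertPerm {L : Type*} {s : ℕ} (b : Fin (s + 1) → L) (p : Fin (s + 1))
    (τ : Equiv.Perm (Fin s)) : (fun i => b (insertPerm p τ i)) =
      Fin.insertNth (α := fun _ => L) p (b 0) fun i => b (τ i).succ := by
  funext i
  refine Fin.succAboveCases p ?_ (fun j => ?_) i
  · rw [insertPerm_self, Fin.insertNth_apply_same]
  · rw [insertPerm_succAbove, Fin.insertNth_apply_succAbove]

lemma insertPerm_bijective (s : ℕ) :
    Function.Bijective fun x : Fin (s + 1) × Equiv.Perm (Fin s) => insertPerm x.1 x.2 := by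
  rw [Fintype.bijective_iff_injective_and_card]
  refine ⟨?_, by simp [Fintype.card_perm, Nat.factorial_succ]⟩
  rintro ⟨p, τ⟩ ⟨p', τ'⟩ h
  simp only at h
  obtain rfl : p = p' := (insertPerm p τ).injective (by
    rw [insertPerm_self, h, insertPerm_self])
  refine Prod.ext rfl (Equiv.ext fun i => ?_)
  have := congrArg (fun e : Equiv.Perm (Fin (s + 1)) => e (p.succAbove i)) h
  simpa [insertPerm_succAbove] using this

/-- If the quasi-shuffle product with any letter multiplies `f` by `c`, then the symmetrization of
`f` does not depend on the letters. -/
lemma sum_perm_of_qsh {L S : Type*} [Add L] [CommRing S] (f : List L → S) (c : S) (h1 : f [] = 1)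
    (hf : ∀ a w, qsh f a w = c * f w) : ∀ {s : ℕ} (b : Fin s → L),
      ∑ σ : Equiv.Perm (Fin s), f (List.ofFn fun i => b (σ i)) = ∏ i ∈ Finset.range s, (c - i)
  | 0, b => by simp [h1]
  | s + 1, b => by
    rw [← (insertPerm_bijective s).sum_comp, Fintype.sum_prod_type_right]
    simp only [comp_insertPerm]
    -- The words in which the letter `b 0` is merged with another one have length `s`.
    have key : ∀ τ : Equiv.Perm (Fin s),
        ∑ p : Fin (s + 1), f (List.ofFn (Fin.insertNth (α := fun _ => L) p (b 0)
          fun i => b (τ i).succ)) = c * f (List.ofFn fun i => b (τ i).succ) -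
        ∑ j : Fin s, f (List.ofFn fun i =>
          Function.update (fun i => b i.succ) j (b 0 + b j.succ) (τ i)) := by
      intro τ
      rw [← hf (b 0), qsh_ofFn, ← Equiv.sum_comp τ fun j : Fin s => f (List.ofFn fun i =>
          Function.update (fun i => b i.succ) j (b 0 + b j.succ) (τ i)), add_sub_assoc, eq_comm,
        add_eq_left, sub_eq_zero]
      refine Finset.sum_congr rfl fun i _ => ?_
      congr 2
      funext j
      rcases eq_or_ne j i with rfl | h
      · simp
      · rw [Function.update_of_ne h, Function.update_of_ne (by simpa using h)]
    simp only [key]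
    rw [Finset.sum_sub_distrib, ← Finset.mul_sum, sum_perm_of_qsh f c h1 hf fun i => b i.succ,
      Finset.sum_comm]
    simp only [sum_perm_of_qsh f c h1 hf (Function.update _ _ _)]
    rw [Finset.prod_range_succ]
    simp
    ring

lemma sum_perm_chi (q n : ℕ) {s : ℕ} (b : Fin s → ℕ+) :
    ∑ σ : Equiv.Perm (Fin s), chi q (q + n) (List.ofFn fun i => b (σ i)) =
      ∏ i ∈ Finset.range s, (chi q (q + n) [1] - i) :=
  sum_perm_of_qsh _ _ (chi_nil _ _) (qsh_chi q n) b

/-- For a constant direction every permutation contributes the same value. -/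
lemma chi_const (q n s : ℕ) (δ : ℕ+) :
    (s.factorial : ℚ) * chi q (q + n) (List.ofFn fun _ : Fin s => δ) =
      ∏ i ∈ Finset.range s, (chi q (q + n) [1] - i) := by
  rw [← sum_perm_chi q n fun _ : Fin s => δ]
  simp [Fintype.card_perm]

/-! ### Laurent expansions on a half disc -/

/-- The Laurent series `f` converges to the function `F` on the intersection of the half plane
`Re z < 0` with some disc around `0`. -/
def Rep (f : LaurentSeries ℂ) (F : ℂ → ℂ) : Prop :=
  ∃ ε : ℝ, 0 < ε ∧ ∀ z : ℂ, z.re < 0 → ‖z‖ < ε → HasSum (fun n : ℤ => f.coeff n * z ^ n) (F z)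

lemma ne_zero_of_re_neg {z : ℂ} (hz : z.re < 0) : z ≠ 0 := by
  rintro rfl
  simp at hz

lemma hasSum_of_forall_eq {ι : Type*} {f g : ι → ℂ} {a : ℂ} (h : ∀ n, f n = g n)
    (hg : HasSum g a) : HasSum f a := by
  rwa [funext h]

lemma Rep.congr {f : LaurentSeries ℂ} {F G : ℂ → ℂ} (hf : Rep f F) {ε : ℝ} (hε : 0 < ε)
    (h : ∀ z : ℂ, z.re < 0 → ‖z‖ < ε → F z = G z) : Rep f G := by
  obtain ⟨δ, hδ, H⟩ := hf
  refine ⟨min ε δ, lt_min hε hδ, fun z hz hz' => ?_⟩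
  rw [← h z hz (hz'.trans_le (min_le_left _ _))]
  exact H z hz (hz'.trans_le (min_le_right _ _))

lemma Rep.add {f g : LaurentSeries ℂ} {F G : ℂ → ℂ} (hf : Rep f F) (hg : Rep g G) :
    Rep (f + g) (fun z => F z + G z) := by
  obtain ⟨δ, hδ, H⟩ := hf
  obtain ⟨ε, hε, H'⟩ := hg
  refine ⟨min ε δ, lt_min hε hδ, fun z hz hz' => ?_⟩
  refine hasSum_of_forall_eq (fun n => ?_) ((H z hz (hz'.trans_le (min_le_right _ _))).add
    (H' z hz (hz'.trans_le (min_le_left _ _))))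
  rw [HahnSeries.coeff_add, add_mul]

lemma Rep.sub {f g : LaurentSeries ℂ} {F G : ℂ → ℂ} (hf : Rep f F) (hg : Rep g G) :
    Rep (f - g) (fun z => F z - G z) := by
  obtain ⟨δ, hδ, H⟩ := hf
  obtain ⟨ε, hε, H'⟩ := hg
  refine ⟨min ε δ, lt_min hε hδ, fun z hz hz' => ?_⟩
  refine hasSum_of_forall_eq (fun n => ?_) ((H z hz (hz'.trans_le (min_le_right _ _))).sub
    (H' z hz (hz'.trans_le (min_le_left _ _))))
  rw [HahnSeries.coeff_sub, sub_mul]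

lemma Rep.zero : Rep 0 (fun _ => 0) :=
  ⟨1, one_pos, fun z _ _ => by simp⟩

lemma Rep.sum {ι : Type*} (s : Finset ι) {f : ι → LaurentSeries ℂ} {F : ι → ℂ → ℂ}
    (h : ∀ i ∈ s, Rep (f i) (F i)) : Rep (∑ i ∈ s, f i) (fun z => ∑ i ∈ s, F i z) := by
  classical
  induction s using Finset.induction_on with
  | empty => simpa using Rep.zero
  | insert a s ha ih =>
    simp only [Finset.sum_insert ha]
    exact (h a (by simp)).add (ih fun i hi => h i (by simp [hi]))

lemma hasSum_coeff_mul (f g : LaurentSeries ℂ) {z : ℂ} (hz : z ≠ 0) (n : ℤ) :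
    HasSum (fun j : ℤ => f.coeff (n - j) * z ^ (n - j) * (g.coeff j * z ^ j))
      ((f * g).coeff n * z ^ n) := by
  let S := Finset.antidiagonal f.isPWO_support g.isPWO_support n
  have hS : ∀ p ∈ S, p.1 = n - p.2 := fun p hp => by
    simp only [S, Finset.mem_antidiagonal] at hp
    omega
  have hinj : Set.InjOn Prod.snd (S : Set (ℤ × ℤ)) := fun p hp p' hp' h =>
    Prod.ext (by rw [hS p hp, hS p' hp', h]) h
  have h4 : (f * g).coeff n * z ^ n =
      ∑ j ∈ S.image Prod.snd, f.coeff (n - j) * z ^ (n - j) * (g.coeff j * z ^ j) := by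
    rw [Finset.sum_image hinj, HahnSeries.coeff_mul, Finset.sum_mul]
    refine Finset.sum_congr rfl fun p hp => ?_
    rw [hS p hp, mul_mul_mul_comm, ← zpow_add₀ hz, sub_add_cancel]
  rw [h4]
  refine hasSum_sum_of_ne_finset_zero fun j hj => ?_
  by_contra hne
  refine hj (Finset.mem_image.2 ⟨(n - j, j), ?_, rfl⟩)
  simp only [S, Finset.mem_antidiagonal, HahnSeries.mem_support]
  exact ⟨fun h => hne (by simp [h]), fun h => hne (by simp [h]), by omega⟩

/-- The product of two sums over `ℤ`, reindexed by the sum of the two indices. -/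
lemma hasSum_mul_shift {f g : ℤ → ℂ} {a b : ℂ} (hf : HasSum f a) (hg : HasSum g b) :
    HasSum (fun p : ℤ × ℤ => f (p.1 - p.2) * g p.2) (a * b) := by
  have h : HasSum (fun p : ℤ × ℤ => f p.1 * g p.2) (a * b) :=
    hf.mul hg (summable_mul_of_summable_norm hf.summable.norm hg.summable.norm)
  let e : ℤ × ℤ ≃ ℤ × ℤ :=
    { toFun := fun p => (p.1 - p.2, p.2)
      invFun := fun p => (p.1 + p.2, p.2)
      left_inv := fun p => by simp
      right_inv := fun p => by simp }
  exact (Equiv.hasSum_iff e).2 h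

lemma Rep.mul {f g : LaurentSeries ℂ} {F G : ℂ → ℂ} (hf : Rep f F) (hg : Rep g G) :
    Rep (f * g) (fun z => F z * G z) := by
  obtain ⟨δ, hδ, H⟩ := hf
  obtain ⟨ε, hε, H'⟩ := hg
  refine ⟨min ε δ, lt_min hε hδ, fun z hz hz' => ?_⟩
  exact HasSum.prod_fiberwise
    (hasSum_mul_shift (H z hz (hz'.trans_le (min_le_right _ _)))
      (H' z hz (hz'.trans_le (min_le_left _ _))))
    fun n => hasSum_coeff_mul f g (ne_zero_of_re_neg hz) n

lemma Rep.single (n : ℤ) : Rep (HahnSeries.single n 1) (fun z => z ^ n) := by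
  refine ⟨1, one_pos, fun z _ _ => ?_⟩
  convert hasSum_single n (f := fun m : ℤ => (HahnSeries.single n (1 : ℂ)).coeff m * z ^ m) ?_
    using 1
  · simp
  · intro m hm
    rw [HahnSeries.coeff_single_of_ne hm, zero_mul]

lemma Rep.ofPowerSeries (p : PowerSeries ℂ) (P : ℂ → ℂ) {ε : ℝ} (hε : 0 < ε)
    (h : ∀ z : ℂ, z.re < 0 → ‖z‖ < ε → HasSum (fun n : ℕ => PowerSeries.coeff n p * z ^ n) (P z)) :
    Rep (HahnSeries.ofPowerSeries ℤ ℂ p) P := by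
  refine ⟨ε, hε, fun z hz hz' => ?_⟩
  refine ((Nat.cast_injective (R := ℤ)).hasSum_iff fun n hn => ?_).1 (by
    convert h z hz hz' using 2 with n
    simp [HahnSeries.ofPowerSeries_apply_coeff])
  rw [PowerSeries.coeff_coe, if_pos, zero_mul]
  by_contra h0
  exact hn ⟨n.toNat, by simpa using h0⟩

lemma Rep.expL : Rep (expL ℂ) Complex.exp := by
  refine Rep.ofPowerSeries _ _ one_pos fun z _ _ => ?_
  have := NormedSpace.expSeries_div_hasSum_exp z
  rw [← Complex.exp_eq_exp_ℂ] at this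
  refine hasSum_of_forall_eq (fun n => ?_) this
  simp [PowerSeries.coeff_exp]
  ring

lemma Rep.one : Rep 1 (fun _ => 1) := by
  simpa using Rep.single 0

lemma Rep.pow {f : LaurentSeries ℂ} {F : ℂ → ℂ} (hf : Rep f F) (n : ℕ) :
    Rep (f ^ n) (fun z => F z ^ n) := by
  induction n with
  | zero => simpa using Rep.one
  | succ n ih => simpa only [pow_succ] using ih.mul hf

/-- A function with a Laurent expansion `f ≠ 0` is a power of `z` times a function that is analytic
and does not vanish at `0`. -/
lemma Rep.exists_analyticAt {f : LaurentSeries ℂ} {F : ℂ → ℂ} (hf : Rep f F) (h0 : f ≠ 0) :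
    ∃ P : ℂ → ℂ, AnalyticAt ℂ P 0 ∧ P 0 ≠ 0 ∧
      ∃ ε : ℝ, 0 < ε ∧ ∀ z : ℂ, z.re < 0 → ‖z‖ < ε → F z = z ^ f.order * P z := by
  obtain ⟨ε, hε, H⟩ := hf
  let c : ℕ → ℂ := fun n => f.coeff (f.order + n)
  have hc : ∀ z : ℂ, z.re < 0 → ‖z‖ < ε → HasSum (fun n => c n * z ^ n) (z ^ (-f.order) * F z) := by
    intro z hz hz'
    have hz0 := ne_zero_of_re_neg hz
    have hinj : Function.Injective fun n : ℕ => f.order + (n : ℤ) := fun a b h => by simpa using h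
    have := ((hinj.hasSum_iff fun n hn => ?_).2 (H z hz hz')).mul_left (z ^ (-f.order))
    · refine hasSum_of_forall_eq (fun n => ?_) this
      simp only [c, Function.comp_apply]
      rw [zpow_add₀ hz0, zpow_neg, zpow_natCast]
      field_simp
    · rw [HahnSeries.coeff_eq_zero_of_lt_order, zero_mul]
      by_contra h
      exact hn ⟨(n - f.order).toNat, by simp at h ⊢; omega⟩
  let q := FormalMultilinearSeries.ofScalars ℂ c
  have hq : ∀ z : ℂ, q.sum z = ∑' n, c n * z ^ n := fun z =>
    congrFun (FormalMultilinearSeries.ofScalarsSum_eq_tsum c) z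
  have hr : 0 < q.radius := by
    have hs := (hc (-(ε / 2) : ℝ) (by simp; linarith)
      (by rw [Complex.norm_real, Real.norm_eq_abs, abs_neg, abs_of_pos] <;> linarith)).summable.norm
    have : ((ε / 2).toNNReal : ENNReal) ≤ q.radius := by
      refine q.le_radius_of_summable_norm ?_
      refine hs.congr fun n => ?_
      rw [FormalMultilinearSeries.ofScalars_norm, norm_mul, norm_pow, Complex.norm_real,
        Real.norm_eq_abs, abs_neg, abs_of_pos (by positivity), Real.coe_toNNReal _ (by positivity)]
    refine lt_of_lt_of_le ?_ this
    simpa using hε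
  have hP := q.hasFPowerSeriesOnBall hr
  refine ⟨q.sum, ⟨q, _, hP⟩, ?_, ε, hε, fun z hz hz' => ?_⟩
  · have : q.sum 0 = c 0 := by
      rw [hq, tsum_eq_single 0 fun n hn => by simp [hn]]
      simp
    rw [this]
    simpa [c] using HahnSeries.coeff_order_eq_zero.not.2 h0
  · rw [hq, (hc z hz hz').tsum_eq, ← mul_assoc, ← zpow_add₀ (ne_zero_of_re_neg hz)]
    simp

lemma exists_re_neg_of_eventually {p : ℂ → Prop} (h : ∀ᶠ z in nhds 0, p z) {ε : ℝ} (hε : 0 < ε) :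
    ∃ z : ℂ, z.re < 0 ∧ ‖z‖ < ε ∧ p z := by
  obtain ⟨δ, hδ, H⟩ := Metric.eventually_nhds_iff.1 h
  have hm : 0 < min ε δ := lt_min hε hδ
  have hn : ‖((-(min ε δ / 2) : ℝ) : ℂ)‖ = min ε δ / 2 := by
    rw [Complex.norm_real, Real.norm_eq_abs, abs_neg, abs_of_pos (by positivity)]
  refine ⟨((-(min ε δ / 2) : ℝ) : ℂ), by rw [Complex.ofReal_re]; linarith, ?_, H ?_⟩
  · rw [hn]
    linarith [min_le_left ε δ]
  · rw [dist_zero_right, hn]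
    linarith [min_le_right ε δ]

lemma Rep.unique {f g : LaurentSeries ℂ} {F : ℂ → ℂ} (hf : Rep f F) (hg : Rep g F) : f = g := by
  by_contra hne
  obtain ⟨P, hP, hP0, ε, hε, H⟩ := (hf.sub hg).exists_analyticAt (sub_ne_zero.2 hne)
  obtain ⟨z, hz, hz', hPz⟩ :=
    exists_re_neg_of_eventually (hP.continuousAt.eventually_ne hP0) hε
  have := H z hz hz'
  rw [sub_self, eq_comm, mul_eq_zero] at this
  exact this.elim (zpow_ne_zero _ (ne_zero_of_re_neg hz)) hPz

lemma Rep.inv {f : LaurentSeries ℂ} {F : ℂ → ℂ} (hf : Rep f F) (h0 : f ≠ 0) :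
    Rep f⁻¹ (fun z => (F z)⁻¹) := by
  obtain ⟨P, hP, hP0, ε, hε, H⟩ := hf.exists_analyticAt h0
  obtain ⟨q, hq⟩ := hP.inv hP0
  rw [hasFPowerSeriesAt_iff] at hq
  obtain ⟨δ, hδ, hq⟩ := Metric.eventually_nhds_iff.1 hq
  have h1 : Rep (HahnSeries.ofPowerSeries ℤ ℂ (PowerSeries.mk q.coeff)) P⁻¹ := by
    refine Rep.ofPowerSeries _ _ hδ fun z _ hz => ?_
    have := hq (y := z) (by simpa using hz)
    rw [zero_add] at this
    refine hasSum_of_forall_eq (fun n => ?_) this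
    simp [mul_comm]
  have h2 := ((Rep.single (-f.order)).mul h1).congr (G := fun z => (F z)⁻¹) hε fun z hz hz' => by
    rw [H z hz hz', mul_inv, zpow_neg]
    rfl
  obtain ⟨η, hη, hη'⟩ := Metric.eventually_nhds_iff.1 (hP.continuousAt.eventually_ne hP0)
  have h3 := (hf.mul h2).congr (G := fun _ => 1) (lt_min hε hη) fun z hz hz' => by
    refine mul_inv_cancel₀ ?_
    rw [H z hz (hz'.trans_le (min_le_left _ _))]
    exact mul_ne_zero (zpow_ne_zero _ (ne_zero_of_re_neg hz))
      (hη' (by simpa using hz'.trans_le (min_le_right _ _)))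
  have h4 := h3.unique Rep.one
  rwa [← eq_inv_of_mul_eq_one_right h4]

lemma Rep.tailProd : ∀ v : List ℕ+,
    Rep (RenQSym.tailProd (RenQSym.expL ℂ) v) (fun z => RenQSym.tailProd (Complex.exp z) v)
  | [] => Rep.one
  | a :: v => by
    have h := Rep.expL.pow (a + weight v)
    have h0 : (1 : LaurentSeries ℂ) - RenQSym.expL ℂ ^ (a + weight v : ℕ) ≠ 0 :=
      sub_ne_zero.2 (expL_pow_ne_one _ (Nat.add_pos_left a.pos _)).symm
    simp only [RenQSym.tailProd, div_eq_mul_inv]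
    exact (h.mul ((Rep.one.sub h).inv h0)).mul (Rep.tailProd v)

lemma laurentMap_expL : laurentMap (algebraMap ℚ ℂ) (expL ℚ) = expL ℂ := by
  ext n
  rw [coeff_laurentMap, expL, expL, PowerSeries.coeff_coe, PowerSeries.coeff_coe]
  split_ifs
  · simp
  · simp [PowerSeries.coeff_exp]

/-! ### Summation over increasing sequences of indices -/

/-- The last entry of an increasing sequence of indices, or `0` for the empty sequence. -/
def lastIdx {r : ℕ} (I : Fin r ↪o ℕ+) : ℕ := Finset.univ.sup fun j => (I j : ℕ)

/-- The exponent `∑ i_j b_j` of `e^z` in the weight of a sequence of indices. -/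
def expo {r : ℕ} (β : Fin r → ℕ+) (I : Fin r ↪o ℕ+) : ℕ := ∑ j, (I j : ℕ) * β j

/-- A composition that is empty or ends with a positive entry. -/
def EndsPos {r : ℕ} (u : Fin r → ℕ) : Prop := ∀ i : Fin r, (i : ℕ) + 1 = r → 0 < u i

lemma lastIdx_lt_iff {r : ℕ} (I : Fin r ↪o ℕ+) (n : ℕ+) : lastIdx I < n ↔ ∀ j, I j < n := by
  rw [lastIdx, Finset.sup_lt_iff n.pos]
  simp

lemma monomialExp_apply {r : ℕ} (u : Fin r → ℕ) (I : Fin r ↪o ℕ+) (j : Fin r) :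
    monomialExp u I (I j) = u j := by
  rw [monomialExp, Finsupp.finsetSum_apply, Finset.sum_eq_single j]
  · simp
  · intro b _ hb
    rw [Finsupp.single_eq_of_ne]
    simpa using hb.symm
  · simp

/-- If the last exponent is positive, then the last index is bounded by the support of the
monomial. -/
lemma indexSet_finite {r : ℕ} {u : Fin r → ℕ} (hu : EndsPos u) (m : ℕ+ →₀ ℕ) :
    (indexSet u m).Finite := by
  let N : ℕ := m.support.sup fun i => (i : ℕ)
  have hN : ∀ I ∈ indexSet u m, ∀ j, (I j : ℕ) < N + 1 := by
    intro I hI j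
    have hr : 0 < r := j.pos
    let l : Fin r := ⟨r - 1, by omega⟩
    have hl : 0 < u l := hu l (by simp [l]; omega)
    have h1 : I j ≤ I l := I.monotone (by simp [Fin.le_def, l]; omega)
    have h2 : I l ∈ m.support := by
      rw [Finsupp.mem_support_iff, ← show monomialExp u I = m from hI, monomialExp_apply]
      exact hl.ne'
    have h3 : ((I l : ℕ+) : ℕ) ≤ N := Finset.le_sup (f := fun i : ℕ+ => (i : ℕ)) h2
    have h4 : (I j : ℕ) ≤ I l := h1
    omega
  have : Function.Injective fun (I : indexSet u m) (j : Fin r) =>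
      (⟨(I.1 j : ℕ), hN I.1 I.2 j⟩ : Fin (N + 1)) := by
    intro I I' h
    refine Subtype.ext (DFunLike.ext _ _ fun j => ?_)
    have := congrFun h j
    simpa using this
  have := Finite.of_injective _ this
  exact Set.toFinite _

lemma summable_norm_pow (x : ℂ) (hx : ‖x‖ < 1) : ∀ {k : ℕ} (β : Fin k → ℕ+),
    Summable fun I : Fin k → ℕ+ => ∏ j, ‖x‖ ^ ((I j : ℕ) * β j)
  | 0, β => by
    have : Finite (Fin 0 → ℕ+) := inferInstance
    exact Summable.of_finite
  | k + 1, β => by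
    have h1 : Summable fun i : ℕ+ => ‖x‖ ^ ((i : ℕ) * β 0) := by
      have h : ‖x‖ ^ (β 0 : ℕ) < 1 := pow_lt_one₀ (norm_nonneg _) hx (β 0).ne_zero
      have := (summable_geometric_of_lt_one (by positivity) h).comp_injective PNat.coe_injective
      refine this.congr fun i => ?_
      simp only [Function.comp_apply]
      rw [← pow_mul, mul_comm]
    have h2 := h1.mul_of_nonneg (summable_norm_pow x hx fun j => β j.succ)
      (fun _ => by positivity) (fun _ => by positivity)
    rw [← (Fin.consEquiv fun _ => ℕ+).summable_iff]
    refine h2.congr fun p => ?_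
    simp [Fin.consEquiv, Fin.prod_univ_succ]

lemma summable_pow {X : Type*} (x : ℂ) (hx : ‖x‖ < 1) {k : ℕ} (β : Fin k → ℕ+)
    (f : X → Fin k ↪o ℕ+) (hf : Function.Injective f) :
    Summable fun a : X => ∏ j, x ^ ((f a j : ℕ) * β j) := by
  refine Summable.of_norm ?_
  have := (summable_norm_pow x hx β).comp_injective (i := fun a j => f a j)
    fun a b h => hf (DFunLike.coe_injective h)
  refine this.congr fun a => ?_
  simp

lemma HasSum.of_fiberwise {X Y : Type*} {w : X → ℂ} (hw : Summable w) (f : X → Y) {g : Y → ℂ}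
    {a : ℂ} (hg : HasSum g a) (h : ∀ y, HasSum (fun x : {x // f x = y} => w x) (g y)) :
    HasSum w a := by
  rw [← (Equiv.sigmaFiberEquiv f).hasSum_iff]
  exact HasSum.sigma_of_hasSum hg h ((Equiv.sigmaFiberEquiv f).summable_iff.2 hw)

/-- The sequences that are bounded below by `n`. -/
abbrev TailSeq (s n : ℕ) : Type := {J : Fin s ↪o ℕ+ // ∀ j, n < J j}

lemma cons_strictMono {s : ℕ} (i : ℕ+) (J : TailSeq s i) :
    StrictMono (Fin.cons i J.1 : Fin (s + 1) → ℕ+) := by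
  intro a b hab
  induction b using Fin.cases with
  | zero => simp at hab
  | succ b =>
    induction a using Fin.cases with
    | zero =>
      rw [Fin.cons_zero, Fin.cons_succ]
      exact J.2 b
    | succ a =>
      rw [Fin.cons_succ, Fin.cons_succ]
      exact J.1.strictMono (by simpa using hab)

/-- The sequences bounded below by `n` with given first entry `i`. -/
def tailSeqFiber (s n : ℕ) (i : {i : ℕ+ // n < i}) :
    {J : TailSeq (s + 1) n // (⟨J.1 0, J.2 0⟩ : {i : ℕ+ // n < i}) = i} ≃ TailSeq s i.1 where
  toFun J := ⟨(Fin.succOrderEmb s).trans J.1.1, fun j => by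
    obtain ⟨J, rfl⟩ := J
    exact J.1.strictMono (Fin.succ_pos j)⟩
  invFun J := ⟨⟨OrderEmbedding.ofStrictMono _ (cons_strictMono i.1 J), fun j => by
    induction j using Fin.cases with
    | zero => exact i.2
    | succ j => exact i.2.trans (J.2 j)⟩, rfl⟩
  left_inv J := by
    obtain ⟨J, rfl⟩ := J
    refine Subtype.ext (Subtype.ext (DFunLike.ext _ _ fun j => ?_))
    induction j using Fin.cases with
    | zero => rfl
    | succ j => rfl
  right_inv J := rfl

/-- The natural numbers enumerate the indices above `n`. -/
def natEquivGt (n : ℕ) : ℕ ≃ {i : ℕ+ // n < i} where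
  toFun l := ⟨⟨n + 1 + l, by omega⟩, by simp; omega⟩
  invFun i := i.1 - (n + 1)
  left_inv l := by simp
  right_inv i := by
    obtain ⟨i, hi⟩ := i
    refine Subtype.ext (PNat.eq ?_)
    simp
    omega

/-- The geometric series over the indices above `n`. -/
lemma hasSum_gt {x : ℂ} (hx : ‖x‖ < 1) (n : ℕ) {B : ℕ} (hB : 0 < B) :
    HasSum (fun i : {i : ℕ+ // n < i} => x ^ ((i.1 : ℕ) * B))
      (x ^ (n * B) * (x ^ B / (1 - x ^ B))) := by
  have h : ‖x ^ B‖ < 1 := by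
    rw [norm_pow]
    exact pow_lt_one₀ (norm_nonneg _) hx hB.ne'
  rw [← (natEquivGt n).hasSum_iff]
  have h2 := (hasSum_geometric_of_norm_lt_one h).mul_left (x ^ ((n + 1) * B))
  have h3 : x ^ (n * B) * (x ^ B / (1 - x ^ B)) = x ^ ((n + 1) * B) * (1 - x ^ B)⁻¹ := by
    ring
  rw [h3]
  refine hasSum_of_forall_eq (fun l => ?_) h2
  simp only [Function.comp_apply, natEquivGt, Equiv.coe_fn_mk, PNat.mk_coe]
  ring

/-- The closed form `tailSum` is the value of the nested geometric sum. -/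
lemma hasSum_tailSum {x : ℂ} (hx : ‖x‖ < 1) : ∀ {s : ℕ} (β : Fin s → ℕ+) (n : ℕ),
    HasSum (fun J : TailSeq s n => ∏ j, x ^ ((J.1 j : ℕ) * β j)) (tailSum x n (List.ofFn β))
  | 0, β, n => by
    let J : TailSeq 0 n := ⟨OrderEmbedding.ofStrictMono Fin.elim0 fun j => j.elim0,
      fun j => j.elim0⟩
    have : Unique (TailSeq 0 n) :=
      ⟨⟨J⟩, fun J' => Subtype.ext (DFunLike.ext _ _ fun j => j.elim0)⟩
    simp
  | s + 1, β, n => by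
    refine HasSum.of_fiberwise (summable_pow x hx β _ Subtype.val_injective)
      (fun J : TailSeq (s + 1) n => (⟨J.1 0, J.2 0⟩ : {i : ℕ+ // n < i}))
      (g := fun i => x ^ ((i.1 : ℕ) * β 0) * tailSum x i.1 (List.ofFn fun j => β j.succ)) ?_ ?_
    · have h := (hasSum_gt hx n (B := β 0 + weight (List.ofFn fun j => β j.succ))
        (Nat.add_pos_left (β 0).pos _)).mul_right (tailProd x (List.ofFn fun j => β j.succ))
      rw [List.ofFn_succ]
      simp only [tailSum, tailProd, weight_cons]
      rw [← mul_assoc]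
      refine hasSum_of_forall_eq (fun i => ?_) h
      rw [mul_add, pow_add]
      ring
    · intro i
      rw [← (tailSeqFiber s n i).symm.hasSum_iff]
      refine hasSum_of_forall_eq (fun J => ?_)
        ((hasSum_tailSum hx (fun j => β j.succ) i.1).mul_left (x ^ ((i.1 : ℕ) * β 0)))
      rw [Function.comp_apply, Fin.prod_univ_succ]
      rfl

section Block

variable {r s : ℕ}

/-- Trailing zeros do not contribute to the monomial. -/
lemma monomialExp_append (u : Fin r → ℕ) (K : Fin (r + s) ↪o ℕ+) :
    monomialExp (Fin.append u fun _ => 0) K = monomialExp u ((Fin.castAddOrderEmb s).trans K) := by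
  simp [monomialExp, Fin.sum_univ_add]

lemma append_strictMono (I : Fin r ↪o ℕ+) (J : TailSeq s (lastIdx I)) :
    StrictMono (Fin.append I J.1 : Fin (r + s) → ℕ+) := by
  intro a b hab
  induction b using Fin.addCases with
  | left b =>
    induction a using Fin.addCases with
    | left a =>
      rw [Fin.append_left, Fin.append_left]
      exact I.strictMono (show (a : ℕ) < b from hab)
    | right a =>
      simp [Fin.lt_def] at hab
      omega
  | right b =>
    induction a using Fin.addCases with
    | left a =>
      rw [Fin.append_left, Fin.append_right]
      exact (lastIdx_lt_iff I _).1 (J.2 b) a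
    | right a =>
      rw [Fin.append_right, Fin.append_right]
      exact J.1.strictMono (Nat.add_lt_add_iff_left.1 (show r + (a : ℕ) < r + b from hab))

/-- The part of a sequence of indices that belongs to the positions before the trailing zeros. -/
def headSeq (u : Fin r → ℕ) (m : ℕ+ →₀ ℕ)
    (K : indexSet (Fin.append u fun _ : Fin s => 0) m) : indexSet u m :=
  ⟨(Fin.castAddOrderEmb s).trans K.1, by
    rw [indexSet, Set.mem_ofPred_eq, ← monomialExp_append]
    exact K.2⟩

/-- The indices at the trailing zeros run freely above the last index before them. -/
def headSeqFiber (u : Fin r → ℕ) (m : ℕ+ →₀ ℕ) (I : indexSet u m) :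
    {K : indexSet (Fin.append u fun _ : Fin s => 0) m // headSeq u m K = I} ≃
      TailSeq s (lastIdx I.1) where
  toFun K := ⟨(Fin.natAddOrderEmb r).trans K.1.1, fun j => by
    obtain ⟨K, rfl⟩ := K
    refine (lastIdx_lt_iff _ _).2 fun i => K.1.strictMono ?_
    exact show (i : ℕ) < r + j by omega⟩
  invFun J := by
    have h : (Fin.castAddOrderEmb s).trans
        (OrderEmbedding.ofStrictMono _ (append_strictMono I.1 J)) =
        I.1 := DFunLike.ext _ _ fun j => Fin.append_left _ _ j
    exact ⟨⟨OrderEmbedding.ofStrictMono _ (append_strictMono I.1 J), by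
      rw [indexSet, Set.mem_ofPred_eq, monomialExp_append, h]
      exact I.2⟩, Subtype.ext h⟩
  left_inv K := by
    obtain ⟨K, rfl⟩ := K
    refine Subtype.ext (Subtype.ext (DFunLike.ext _ _ fun j => ?_))
    induction j using Fin.addCases with
    | left j => exact Fin.append_left _ _ j
    | right j => exact Fin.append_right _ _ j
  right_inv J := Subtype.ext (DFunLike.ext _ _ fun j => Fin.append_right _ _ j)

variable {F : Type*} [Field F]

/-- The closed form of the coefficient of `x^m` in the regularization at `t = 0`, with `e^z`
replaced by `x`: a finite sum over the indices before the trailing zeros. -/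
noncomputable def blockSum (x : F) {u : Fin r → ℕ} (hu : EndsPos u) (β : Fin r → ℕ+) (v : List ℕ+)
    (m : ℕ+ →₀ ℕ) : F :=
  ∑ I ∈ (indexSet_finite hu m).toFinset, x ^ expo β I * tailSum x (lastIdx I) v

lemma hasSum_blockSum {x : ℂ} (hx : ‖x‖ < 1) {u : Fin r → ℕ} (hu : EndsPos u) (β : Fin r → ℕ+)
    (γ : Fin s → ℕ+) (m : ℕ+ →₀ ℕ) :
    HasSum (fun K : indexSet (Fin.append u fun _ : Fin s => 0) m =>
        ∏ j, x ^ ((K.1 j : ℕ) * Fin.append β γ j))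
      (blockSum x hu β (List.ofFn γ) m) := by
  have := (indexSet_finite hu m).fintype
  refine HasSum.of_fiberwise (summable_pow x hx _ _ Subtype.val_injective) (headSeq u m)
    (g := fun I => x ^ expo β I.1 * tailSum x (lastIdx I.1) (List.ofFn γ)) ?_ ?_
  · rw [blockSum, Finset.sum_subtype _ (p := fun I => I ∈ indexSet u m)
      (f := fun I => x ^ expo β I * tailSum x (lastIdx I) (List.ofFn γ)) (by simp)]
    exact hasSum_fintype _
  · intro I
    rw [← (headSeqFiber u m I).symm.hasSum_iff]
    refine hasSum_of_forall_eq (fun J => ?_) ((hasSum_tailSum hx γ _).mul_left _)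
    rw [Function.comp_apply, Fin.prod_univ_add, expo, ← Finset.prod_pow_eq_pow_sum]
    simp only [headSeqFiber, Equiv.coe_fn_symm_mk, OrderEmbedding.coe_ofStrictMono,
      Fin.append_left, Fin.append_right]

lemma regWeight_eq {k : ℕ} (β : Fin k → ℕ+) (t : ℝ) (z : ℂ) (K : Fin k ↪o ℕ+) :
    regWeight β t z K = Complex.exp ((t : ℂ) * ((∑ j, (β j : ℕ) : ℕ) : ℂ) * z) *
      ∏ j, Complex.exp z ^ ((K j : ℕ) * β j) := by
  rw [regWeight, Nat.cast_sum, Finset.mul_sum, Finset.sum_mul, Complex.exp_sum,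
    ← Finset.prod_mul_distrib]
  refine Finset.prod_congr rfl fun j _ => ?_
  rw [← Complex.exp_nat_mul, ← Complex.exp_add]
  congr 1
  push_cast
  ring

lemma norm_exp_lt_one {z : ℂ} (hz : z.re < 0) : ‖Complex.exp z‖ < 1 := by
  rw [Complex.norm_exp]
  simpa using hz

lemma hasSum_regWeight {u : Fin r → ℕ} (hu : EndsPos u) (β : Fin r → ℕ+) (γ : Fin s → ℕ+)
    (m : ℕ+ →₀ ℕ) (t : ℝ) {z : ℂ} (hz : z.re < 0) :
    HasSum (fun K : indexSet (Fin.append u fun _ : Fin s => 0) m =>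
        regWeight (Fin.append β γ) t z K)
      (Complex.exp ((t : ℂ) * ((∑ j, ((Fin.append β γ j : ℕ+) : ℕ) : ℕ) : ℂ) * z) *
        blockSum (Complex.exp z) hu β (List.ofFn γ) m) :=
  hasSum_of_forall_eq (fun _ => regWeight_eq _ t z _)
    ((hasSum_blockSum (norm_exp_lt_one hz) hu β γ m).mul_left _)

lemma Rep.blockSum {u : Fin r → ℕ} (hu : EndsPos u) (β : Fin r → ℕ+) (v : List ℕ+)
    (m : ℕ+ →₀ ℕ) : Rep (RenQSym.blockSum (RenQSym.expL ℂ) hu β v m)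
      (fun z => RenQSym.blockSum (Complex.exp z) hu β v m) :=
  Rep.sum _ fun _ _ => (Rep.expL.pow _).mul ((Rep.expL.pow _).mul (Rep.tailProd v))

lemma map_blockSum {F' : Type*} [Field F'] (ρ : F →+* F') (x : F) {u : Fin r → ℕ} (hu : EndsPos u)
    (β : Fin r → ℕ+) (v : List ℕ+) (m : ℕ+ →₀ ℕ) :
    ρ (blockSum x hu β v m) = blockSum (ρ x) hu β v m := by
  simp [blockSum, tailSum, map_tailProd]

end Block

/-- Every composition is the concatenation of one that is empty or ends with a positive entry and a
sequence of zeros. -/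
lemma exists_eq_append {k : ℕ} (α : Fin k → ℕ) : ∃ (r s : ℕ) (h : r + s = k) (u : Fin r → ℕ),
    EndsPos u ∧ ∀ i, α (Fin.cast h i) = Fin.append u (fun _ : Fin s => 0) i := by
  classical
  have hP : ∃ r : ℕ, ∀ i : Fin k, r ≤ (i : ℕ) → α i = 0 := ⟨k, fun i hi => absurd i.2 (not_lt.2 hi)⟩
  have hr : Nat.find hP ≤ k := Nat.find_min' hP fun i hi => absurd i.2 (not_lt.2 hi)
  refine ⟨Nat.find hP, k - Nat.find hP, by omega, fun i => α ⟨i, by omega⟩, fun i hi => ?_,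
    fun i => ?_⟩
  · by_contra h0
    refine Nat.find_min hP i.2 fun j hj => ?_
    rcases hj.eq_or_lt with h | h
    · have : j = ⟨i, by omega⟩ := Fin.ext h.symm
      rw [this]
      simpa using h0
    · exact Nat.find_spec hP j (by omega)
  · induction i using Fin.addCases with
    | left i =>
      rw [Fin.append_left]
      rfl
    | right i =>
      rw [Fin.append_right]
      exact Nat.find_spec hP _ (by simp)

/-! ### Existence and uniqueness of the regularization -/

/-- The Laurent series in `z` formed by the coefficients of `x^m`, at a real value of `t`. -/
noncomputable def slice (Φ : LaurentSeries (PolyT ℚ)) (m : ℕ+ →₀ ℕ) (t : ℝ) : LaurentSeries ℂ :=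
  laurentMapAdd (AddMonoidHom.mk' (fun p : PolyT ℚ =>
    p.sum fun s g => ((MvPowerSeries.coeff m g : ℚ) : ℂ) * (t : ℂ) ^ s) fun p q =>
      Polynomial.sum_add_index p q _ (by simp) (by intros; simp [add_mul])) Φ

lemma coeff_slice (Φ : LaurentSeries (PolyT ℚ)) (m : ℕ+ →₀ ℕ) (t : ℝ) (n : ℤ) :
    (slice Φ m t).coeff n = coeffAt Φ m n t := rfl

lemma rep_slice_iff (Φ : LaurentSeries (PolyT ℚ)) (m : ℕ+ →₀ ℕ) (t : ℝ) (F : ℂ → ℂ) :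
    Rep (slice Φ m t) F ↔ ∃ ε : ℝ, 0 < ε ∧ ∀ z : ℂ, z.re < 0 → ‖z‖ < ε →
      HasSum (fun n : ℤ => coeffAt Φ m n t * z ^ n) (F z) := Iff.rfl

/-- A series in `ℚ[[X]][t][z⁻¹, z]]` is determined by its coefficients at all `t ≥ 0`. -/
lemma eq_of_slice_eq {Φ Ψ : LaurentSeries (PolyT ℚ)}
    (h : ∀ m (t : ℝ), 0 ≤ t → slice Φ m t = slice Ψ m t) : Φ = Ψ := by
  ext n d m
  have hpoly : ∀ (p : PolyT ℚ) (t : ℝ),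
      (p.sum fun s g => ((MvPowerSeries.coeff m g : ℚ) : ℂ) * (t : ℂ) ^ s) =
        Polynomial.eval (t : ℂ) (p.sum fun s g =>
          Polynomial.monomial s ((MvPowerSeries.coeff m g : ℚ) : ℂ)) := fun p t => by
    simp [Polynomial.sum_def, Polynomial.eval_finsetSum, Polynomial.eval_monomial]
  have hcoeff : ∀ p : PolyT ℚ, ((p.sum fun s g =>
      Polynomial.monomial s ((MvPowerSeries.coeff m g : ℚ) : ℂ)).coeff d) =
        ((MvPowerSeries.coeff m (p.coeff d) : ℚ) : ℂ) := fun p => by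
    simp only [Polynomial.sum_def, Polynomial.finsetSum_coeff, Polynomial.coeff_monomial]
    rw [Finset.sum_ite_eq']
    split_ifs with hd
    · rfl
    · rw [Polynomial.notMem_support_iff.1 hd]
      simp
  have heq : ((Φ.coeff n).sum fun s g =>
      Polynomial.monomial s ((MvPowerSeries.coeff m g : ℚ) : ℂ)) = ((Ψ.coeff n).sum fun s g =>
        Polynomial.monomial s ((MvPowerSeries.coeff m g : ℚ) : ℂ)) := by
    refine Polynomial.eq_of_infinite_eval_eq _ _ ?_
    refine Set.infinite_of_injective_forall_mem (f := fun i : ℕ => (i : ℂ)) Nat.cast_injective ?_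
    intro i
    have := congrArg (fun f => HahnSeries.coeff f n) (h m i (by positivity))
    simp only [coeff_slice, coeffAt, hpoly] at this
    simpa using this
  have := congrArg (fun p => Polynomial.coeff p d) heq
  simp only [hcoeff] at this
  exact_mod_cast this

lemma IsRegularization.unique {k : ℕ} {α : Fin k → ℕ} {β : Fin k → ℕ+}
    {Φ Ψ : LaurentSeries (PolyT ℚ)} (hΦ : IsRegularization α β Φ) (hΨ : IsRegularization α β Ψ) :
    Φ = Ψ :=
  eq_of_slice_eq fun m t ht => Rep.unique (f := slice Φ m t) (hΦ m t ht).2 (hΨ m t ht).2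

/-- The pole of `x^B / (1 - x^B)` at `z = 0`, where `x = e^z`, is simple. -/
lemma isReg_single_mul_inv {B : ℕ} (hB : 0 < B) :
    IsReg (HahnSeries.single (1 : ℤ) (1 : ℚ) * (1 - expL ℚ ^ B)⁻¹) := by
  have h1 : (1 : LaurentSeries ℚ) - expL ℚ ^ B ≠ 0 := sub_ne_zero.2 (expL_pow_ne_one _ hB).symm
  obtain ⟨p, hp0, hp⟩ := exists_one_sub_expL_pow (k := ℚ)
  have hB0 : (B : ℚ) ≠ 0 := Nat.cast_ne_zero.2 hB.ne'
  have h2 : HahnSeries.single (1 : ℤ) (1 : ℚ) * (1 - expL ℚ ^ B)⁻¹ =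
      HahnSeries.ofPowerSeries ℤ ℚ (PowerSeries.C (B : ℚ)⁻¹ * PowerSeries.rescale (B : ℚ) p⁻¹) := by
    rw [mul_inv_eq_iff_eq_mul₀ h1, hp, map_mul, HahnSeries.ofPowerSeries_C, HahnSeries.C_apply,
      mul_mul_mul_comm, HahnSeries.single_mul_single, ← map_mul, ← map_mul,
      PowerSeries.inv_mul_cancel p hp0, map_one (PowerSeries.rescale (B : ℚ)),
      map_one (HahnSeries.ofPowerSeries ℤ ℚ), mul_one, inv_mul_cancel₀ hB0, zero_add]
  rw [h2]
  exact isReg_ofPowerSeries _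

lemma isReg_single_mul_tailProd : ∀ v : List ℕ+,
    IsReg (HahnSeries.single (v.length : ℤ) (1 : ℚ) * tailProd (expL ℚ) v)
  | [] => by simpa [tailProd] using IsReg.one
  | a :: v => by
    have h := (((isReg_single_mul_inv (B := a + weight v) (Nat.add_pos_left a.pos _)).mul
      (isReg_expL_pow (a + weight v))).mul (isReg_single_mul_tailProd v))
    have e : HahnSeries.single ((a :: v).length : ℤ) (1 : ℚ) =
        HahnSeries.single (1 : ℤ) (1 : ℚ) * HahnSeries.single (v.length : ℤ) (1 : ℚ) := by
      rw [HahnSeries.single_mul_single]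
      simp [add_comm]
    rw [e, tailProd, div_eq_mul_inv]
    convert h using 1
    ring

section Expansion

variable {r s : ℕ}

/-- The order of the pole is bounded by the number of trailing zeros, uniformly in the monomial. -/
lemma coeff_blockSum_of_lt {u : Fin r → ℕ} (hu : EndsPos u) (β : Fin r → ℕ+) (v : List ℕ+)
    (m : ℕ+ →₀ ℕ) {n : ℤ} (hn : n < -v.length) : (blockSum (expL ℚ) hu β v m).coeff n = 0 := by
  have h : IsReg (HahnSeries.single (v.length : ℤ) (1 : ℚ) * blockSum (expL ℚ) hu β v m) := by
    rw [blockSum, Finset.mul_sum]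
    refine IsReg.sum _ fun I _ => ?_
    rw [tailSum, mul_left_comm, mul_left_comm (HahnSeries.single _ _)]
    exact (isReg_expL_pow _).mul ((isReg_expL_pow _).mul (isReg_single_mul_tailProd v))
  have := h (n + v.length) (by omega)
  rwa [HahnSeries.coeff_single_mul, one_mul, add_sub_cancel_right] at this

/-- If the pole of `f` has order at most `s`, then the Cauchy product with a power series can be
summed over a range that depends on `s` and `n` only. -/
lemma coeff_mul_ofPowerSeries {A : Type*} [CommRing A] (f : LaurentSeries A) (s : ℕ)
    (hf : ∀ n : ℤ, n < -s → f.coeff n = 0) (p : PowerSeries A) (n : ℤ) :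
    (f * HahnSeries.ofPowerSeries ℤ A p).coeff n =
      ∑ d ∈ Finset.range (n + s + 1).toNat, f.coeff (n - d) * PowerSeries.coeff d p := by
  have hreg : IsReg (HahnSeries.single (s : ℤ) 1 * f) := fun k hk => by
    rw [HahnSeries.coeff_single_mul, one_mul]
    exact hf _ (by omega)
  obtain ⟨g, hg⟩ := hreg.exists_powerSeries
  have hcoeff : ∀ i : ℕ, f.coeff (i - s) = PowerSeries.coeff i g := fun i => by
    have := congrArg (fun f => HahnSeries.coeff f (i : ℤ)) hg
    simpa [HahnSeries.coeff_single_mul, HahnSeries.ofPowerSeries_apply_coeff] using this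
  have hshift : (f * HahnSeries.ofPowerSeries ℤ A p).coeff n =
      (HahnSeries.ofPowerSeries ℤ A (p * g)).coeff (n + s) := by
    rw [mul_comm p, map_mul, ← hg, mul_assoc, HahnSeries.coeff_single_mul, one_mul,
      add_sub_cancel_right]
  rw [hshift]
  rcases lt_or_ge (n + s) 0 with h | h
  · rw [isReg_ofPowerSeries _ _ h, show (n + s + 1).toNat = 0 by omega, Finset.range_zero,
      Finset.sum_empty]
  · obtain ⟨N, hN⟩ := Int.eq_ofNat_of_zero_le h
    rw [hN, HahnSeries.ofPowerSeries_apply_coeff, PowerSeries.coeff_mul,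
      Finset.Nat.sum_antidiagonal_eq_sum_range_succ_mk,
      show ((N : ℤ) + 1).toNat = N.succ by omega]
    refine Finset.sum_congr rfl fun d hd => ?_
    have hd' : d ≤ N := by simpa [Nat.lt_succ_iff] using hd
    rw [← hcoeff, mul_comm]
    congr 2
    push_cast [hd']
    omega

/-- The coefficient of `z^n t^d` in the expansion of the regularization. -/
noncomputable def expansionCoeff {u : Fin r → ℕ} (hu : EndsPos u) (β : Fin r → ℕ+) (v : List ℕ+)
    (b : ℕ) (n : ℤ) (d : ℕ) : PowX ℚ := fun m =>
  (blockSum (expL ℚ) hu β v m).coeff (n - d) * ((b : ℚ) ^ d / d.factorial)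

/-- The expansion of the regularization: its coefficients are read off from the product of the
expansion at `t = 0` with the exponential series of `e^{tbz}`, where `b` is the total weight. -/
noncomputable def expansion {u : Fin r → ℕ} (hu : EndsPos u) (β : Fin r → ℕ+) (v : List ℕ+)
    (b : ℕ) : LaurentSeries (PolyT ℚ) :=
  HahnSeries.ofSuppBddBelow (fun n : ℤ => ∑ d ∈ Finset.range (n + v.length + 1).toNat,
    Polynomial.monomial d (expansionCoeff hu β v b n d))
    ⟨-v.length, fun n hn => by
      by_contra h
      refine hn ?_
      simp only
      rw [show (n + v.length + 1).toNat = 0 by omega, Finset.range_zero, Finset.sum_empty]⟩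

lemma coeff_coeff_expansion {u : Fin r → ℕ} (hu : EndsPos u) (β : Fin r → ℕ+) (v : List ℕ+)
    (b : ℕ) (n : ℤ) (d : ℕ) : ((expansion hu β v b).coeff n).coeff d =
      if d ∈ Finset.range (n + v.length + 1).toNat then expansionCoeff hu β v b n d else 0 := by
  have h : (expansion hu β v b).coeff n = ∑ d ∈ Finset.range (n + v.length + 1).toNat,
      Polynomial.monomial d (expansionCoeff hu β v b n d) := rfl
  rw [h, Polynomial.finsetSum_coeff]
  simp only [Polynomial.coeff_monomial]
  rw [Finset.sum_ite_eq']

lemma slice_expansion {u : Fin r → ℕ} (hu : EndsPos u) (β : Fin r → ℕ+) (v : List ℕ+) (b : ℕ)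
    (m : ℕ+ →₀ ℕ) (t : ℝ) :
    slice (expansion hu β v b) m t = laurentMap (algebraMap ℚ ℂ) (blockSum (expL ℚ) hu β v m) *
      HahnSeries.ofPowerSeries ℤ ℂ (PowerSeries.rescale ((t : ℂ) * b) (PowerSeries.exp ℂ)) := by
  ext n
  rw [coeff_mul_ofPowerSeries _ v.length fun k hk => by
    rw [coeff_laurentMap, coeff_blockSum_of_lt hu β v m hk, map_zero]]
  rw [coeff_slice, coeffAt, Polynomial.sum_eq_of_subset (s := Finset.range (n + v.length + 1).toNat)
    _ (by simp)]
  · refine Finset.sum_congr rfl fun d hd => ?_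
    rw [coeff_coeff_expansion, if_pos hd, show MvPowerSeries.coeff m (expansionCoeff hu β v b n d) =
        (blockSum (expL ℚ) hu β v m).coeff (n - d) * ((b : ℚ) ^ d / d.factorial) from rfl]
    simp [PowerSeries.coeff_exp]
    ring
  · intro d hd
    by_contra h
    rw [Polynomial.mem_support_iff, coeff_coeff_expansion, if_neg h] at hd
    exact hd rfl

lemma rep_exp_mul (c : ℂ) :
    Rep (HahnSeries.ofPowerSeries ℤ ℂ (PowerSeries.rescale c (PowerSeries.exp ℂ)))
      (fun z => Complex.exp (c * z)) := by
  refine Rep.ofPowerSeries _ _ one_pos fun z _ _ => ?_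
  have := NormedSpace.expSeries_div_hasSum_exp (c * z)
  rw [← Complex.exp_eq_exp_ℂ] at this
  refine hasSum_of_forall_eq (fun n => ?_) this
  simp [PowerSeries.coeff_exp, mul_pow]
  ring

lemma isRegularization_expansion {u : Fin r → ℕ} (hu : EndsPos u) (β : Fin r → ℕ+)
    (γ : Fin s → ℕ+) : IsRegularization (Fin.append u fun _ => 0) (Fin.append β γ)
      (expansion hu β (List.ofFn γ) (∑ j, ((Fin.append β γ j : ℕ+) : ℕ))) := by
  intro m t _
  refine ⟨fun z hz => (hasSum_regWeight hu β γ m t hz).summable, ?_⟩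
  refine (rep_slice_iff _ m t _).1 ?_
  rw [slice_expansion, map_blockSum, laurentMap_expL, mul_comm]
  refine ((rep_exp_mul _).mul (Rep.blockSum hu β (List.ofFn γ) m)).congr one_pos fun z hz _ => ?_
  exact (hasSum_regWeight hu β γ m t hz).tsum_eq.symm

lemma exists_isRegularization {k : ℕ} (α : Fin k → ℕ) (β : Fin k → ℕ+) :
    ∃ Φ, IsRegularization α β Φ := by
  obtain ⟨r, s, rfl, u, hu, h⟩ := exists_eq_append α
  obtain rfl : α = Fin.append u fun _ => 0 := funext h
  rw [← Fin.append_castAdd_natAdd (f := β)]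
  exact ⟨_, isRegularization_expansion hu _ _⟩

lemma isRegularization_regularization {k : ℕ} (α : Fin k → ℕ) (β : Fin k → ℕ+) :
    IsRegularization α β (regularization (List.ofFn fun j => (α j, β j))) := by
  set w : List Letter := List.ofFn fun j => (α j, β j) with hw
  have h : IsRegularization (fun j => (w.get j).1) (fun j => (w.get j).2) (regularization w) := by
    have hex := exists_isRegularization (fun j => (w.get j).1) (fun j => (w.get j).2)
    rw [regularization, dif_pos hex]
    exact hex.choose_spec
  have hk : w.length = k := by simp [hw]
  have hget : ∀ j : Fin w.length, w.get j = (α (Fin.cast hk j), β (Fin.cast hk j)) := fun j => by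
    simp [hw]
    exact ⟨rfl, rfl⟩
  have h' : ∀ (l : ℕ) (hl : l = k) (Φ : LaurentSeries (PolyT ℚ)),
      IsRegularization (fun j => α (Fin.cast hl j)) (fun j => β (Fin.cast hl j)) Φ →
        IsRegularization α β Φ := by
    rintro l rfl Φ hΦ
    exact hΦ
  refine h' _ hk _ ?_
  simpa only [hget] using h

lemma weight_ofFn : ∀ {s : ℕ} (γ : Fin s → ℕ+), weight (List.ofFn γ) = ∑ j, (γ j : ℕ)
  | 0, _ => by simp
  | s + 1, γ => by rw [List.ofFn_succ, weight_cons, weight_ofFn, Fin.sum_univ_succ]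

/-- Evaluation at `t = q` followed by extraction of the coefficient of `x^m`. -/
noncomputable def coeffEval (q : ℕ) (m : ℕ+ →₀ ℕ) : PolyT ℚ →+ ℚ :=
  (MvPowerSeries.coeff (R := ℚ) m).toAddMonoidHom.comp
    (Polynomial.evalRingHom (q : PowX ℚ)).toAddMonoidHom

lemma coeffEval_apply (q : ℕ) (m : ℕ+ →₀ ℕ) (p : PolyT ℚ) :
    coeffEval q m p = MvPowerSeries.coeff m (p.eval (q : PowX ℚ)) := rfl

lemma laurentMap_coeffEval (q : ℕ) (m : ℕ+ →₀ ℕ) (Φ : LaurentSeries (PolyT ℚ)) :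
    laurentMap (algebraMap ℚ ℂ) (laurentMapAdd (coeffEval q m) Φ) = slice Φ m q := by
  ext n
  rw [coeff_laurentMap, coeff_laurentMapAdd, coeff_slice, coeffAt, coeffEval_apply,
    Polynomial.eval_eq_sum, Polynomial.sum_def, Polynomial.sum_def, map_sum, map_sum]
  refine Finset.sum_congr rfl fun d _ => ?_
  have h : ((q : PowX ℚ)) ^ d = MvPowerSeries.C ((q : ℚ) ^ d) := by simp
  rw [h, MvPowerSeries.coeff_mul_C]
  simp

/-- The coefficients of the regularization at `t = q`, for a composition whose trailing zeros have
been split off. -/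
lemma coeffEval_regularization {u : Fin r → ℕ} (hu : EndsPos u) (β : Fin r → ℕ+)
    (γ : Fin s → ℕ+) (q : ℕ) (m : ℕ+ →₀ ℕ) :
    laurentMapAdd (coeffEval q m)
      (regularization
        (List.ofFn fun j => (Fin.append u (fun _ : Fin s => 0) j, Fin.append β γ j))) =
    ∑ I ∈ (indexSet_finite hu m).toFinset,
      expL ℚ ^ (q * (∑ j, (β j : ℕ)) + expo β I) *
        tailSum (expL ℚ) (q + lastIdx I) (List.ofFn γ) := by
  rw [(isRegularization_regularization _ _).unique (isRegularization_expansion hu β γ)]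
  refine laurentMap_injective (algebraMap ℚ ℂ).injective ?_
  rw [laurentMap_coeffEval, slice_expansion]
  have h1 : HahnSeries.ofPowerSeries ℤ ℂ (PowerSeries.rescale
      (((q : ℝ) : ℂ) * ((∑ j, ((Fin.append β γ j : ℕ+) : ℕ) : ℕ) : ℂ)) (PowerSeries.exp ℂ)) =
      laurentMap (algebraMap ℚ ℂ)
        (expL ℚ ^ (q * ((∑ j, (β j : ℕ)) + weight (List.ofFn γ)))) := by
    rw [map_pow, laurentMap_expL, expL_pow]
    congr 3
    simp [Fin.sum_univ_add, weight_ofFn]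
  rw [h1, ← map_mul, blockSum, Finset.sum_mul]
  congr 1
  refine Finset.sum_congr rfl fun I _ => ?_
  simp only [tailSum]
  ring

end Expansion

/-! ### Renormalization of a word with trailing zeros -/

/-- A polynomial in `t` over `ℚ[[X]]` is determined by its values at natural numbers. -/
lemma coeffEval_ext {p p' : PolyT ℚ} (h : ∀ q m, coeffEval q m p = coeffEval q m p') : p = p' := by
  have : IsDomain (PowX ℚ) := NoZeroDivisors.to_isDomain _
  have : CharZero (PowX ℚ) := algebraRat.charZero _
  refine Polynomial.eq_of_infinite_eval_eq _ _ ?_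
  refine Set.infinite_of_injective_forall_mem (f := fun q : ℕ => (q : PowX ℚ)) Nat.cast_injective ?_
  exact fun q => MvPowerSeries.ext fun m => h q m

lemma sum_indexSet_fin_zero {S : Type*} [AddCommMonoid S] {u : Fin 0 → ℕ} (hu : EndsPos u)
    (m : ℕ+ →₀ ℕ) (c : S) : ∑ _I ∈ (indexSet_finite hu m).toFinset, c = if m = 0 then c else 0 := by
  let I : Fin 0 ↪o ℕ+ := OrderEmbedding.ofStrictMono Fin.elim0 fun j => j.elim0
  have huniq : ∀ I', I' = I := fun I' => DFunLike.ext _ _ fun j => j.elim0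
  have hmem : ∀ I' : Fin 0 ↪o ℕ+, I' ∈ (indexSet_finite hu m).toFinset ↔ m = 0 := fun I' => by
    rw [Set.Finite.mem_toFinset, indexSet, Set.mem_ofPred_eq, monomialExp, Fin.sum_univ_zero,
      eq_comm]
  split_ifs with h
  · rw [Finset.sum_eq_single I (fun I' _ h' => absurd (huniq I') h')
      fun h' => absurd ((hmem I).2 h) h']
  · exact Finset.sum_eq_zero fun I' hI' => absurd ((hmem I').1 hI') h

lemma endsPos_fin_zero (u : Fin 0 → ℕ) : EndsPos u := fun i => i.elim0

lemma phi_rat (w : List Letter) : phi ℚ w = regularization w := by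
  refine HahnSeries.ext (funext fun n => ?_)
  have : Polynomial.mapRingHom (MvPowerSeries.map (σ := ℕ+) (algebraMap ℚ ℚ)) =
      RingHom.id (PolyT ℚ) := by
    rw [Algebra.algebraMap_self, MvPowerSeries.map_id, Polynomial.mapRingHom_id]
  exact congrArg (fun ρ : PolyT ℚ →+* PolyT ℚ => ρ ((regularization w).coeff n)) this

lemma phi_eq (R : Type*) [CommRing R] [Algebra ℚ R] (w : List Letter) : phi R w =
    laurentMap (Polynomial.mapRingHom (MvPowerSeries.map (σ := ℕ+) (algebraMap ℚ R)))
      (phi ℚ w) := by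
  rw [phi_rat]
  rfl

lemma word_append {r s : ℕ} (u : Fin r → ℕ) (β : Fin r → ℕ+) (γ : Fin s → ℕ+) :
    (List.ofFn fun j => ((Fin.append u (fun _ : Fin s => 0) j, Fin.append β γ j) : Letter)) =
      (List.ofFn fun j => (u j, β j)) ++ (List.ofFn γ).map fun b => (0, b) := by
  rw [List.map_ofFn, ← List.ofFn_fin_append]
  congr 1
  funext j
  induction j using Fin.addCases with
  | left j => simp
  | right j => simp

/-- The regularization at `t = q`. -/
noncomputable def phiEval (q : ℕ) (w : List Letter) : LaurentSeries (PowX ℚ) :=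
  laurentMap (Polynomial.evalRingHom (q : PowX ℚ)) (phi ℚ w)

/-- The extraction of the coefficient of `x^m` from a Laurent series over `ℚ[[X]]`. -/
noncomputable def coeffL (m : ℕ+ →₀ ℕ) : LaurentSeries (PowX ℚ) →+ LaurentSeries ℚ :=
  laurentMapAdd (MvPowerSeries.coeff (R := ℚ) m).toAddMonoidHom

lemma coeff_coeffL (m : ℕ+ →₀ ℕ) (f : LaurentSeries (PowX ℚ)) (n : ℤ) :
    (coeffL m f).coeff n = MvPowerSeries.coeff m (f.coeff n) := rfl

lemma coeffL_ext {f g : LaurentSeries (PowX ℚ)} (h : ∀ m, coeffL m f = coeffL m g) : f = g := by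
  ext n m
  exact congrArg (fun f => HahnSeries.coeff f n) (h m)

lemma coeffL_mul (m : ℕ+ →₀ ℕ) (f : LaurentSeries (PowX ℚ)) (g : LaurentSeries ℚ) :
    coeffL m (f * laurentMap MvPowerSeries.C g) = coeffL m f * g :=
  laurentMapAdd_mul _ _ (fun a b => MvPowerSeries.coeff_mul_C m a b) f g

/-- The coefficient of `x^m` in the regularization is a finite sum, over the indices before the
trailing zeros, of exponentials times nested geometric sums. -/
lemma coeffL_phiEval {r : ℕ} {u : Fin r → ℕ} (hu : EndsPos u) (β : Fin r → ℕ+) (v : List ℕ+)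
    (q : ℕ) (m : ℕ+ →₀ ℕ) :
    coeffL m (phiEval q ((List.ofFn fun j => (u j, β j)) ++ v.map fun b => (0, b))) =
      ∑ I ∈ (indexSet_finite hu m).toFinset,
        expL ℚ ^ (q * (∑ j, (β j : ℕ)) + expo β I) * tailSum (expL ℚ) (q + lastIdx I) v := by
  have h := coeffEval_regularization hu β v.get q m
  rw [word_append, List.ofFn_get] at h
  rw [← h, ← phi_rat]
  rfl

lemma phiEval_map_zero (q : ℕ) (v : List ℕ+) :
    phiEval q (v.map fun b => (0, b)) = laurentMap MvPowerSeries.C (tailSum (expL ℚ) q v) := by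
  refine coeffL_ext fun m => ?_
  have h := coeffL_phiEval (endsPos_fin_zero Fin.elim0) Fin.elim0 v q m
  have h0 : ∀ I : Fin 0 ↪o ℕ+, expL ℚ ^ (q * (∑ j, ((Fin.elim0 j : ℕ+) : ℕ)) + expo Fin.elim0 I) *
      tailSum (expL ℚ) (q + lastIdx I) v = tailSum (expL ℚ) q v := fun I => by
    simp [expo, lastIdx]
  simp only [h0] at h
  rw [sum_indexSet_fin_zero (endsPos_fin_zero _), List.ofFn_zero, List.nil_append] at h
  rw [h]
  ext n
  rw [coeff_coeffL, coeff_laurentMap, MvPowerSeries.coeff_C]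
  split_ifs <;> rfl

lemma birkhoffMinus_phiEval_map_zero (q : ℕ) (v : List ℕ+) :
    birkhoffMinus (phiEval q) (v.map fun b => (0, b)) =
      laurentMap MvPowerSeries.C (birkhoffMinus (tailSum (expL ℚ) q) v) :=
  birkhoffMinus_map _ _ _ _ (phiEval_map_zero q) v

/-- The coefficient of `x^m` in the renormalized series is a finite sum of exponentials times the
renormalized nested sums `psi`. -/
lemma coeffL_conv {r : ℕ} {u : Fin r → ℕ} (hu : EndsPos u) (β : Fin r → ℕ+) (v : List ℕ+)
    (q : ℕ) (m : ℕ+ →₀ ℕ) :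
    coeffL m (conv (fun w => phiEval q ((List.ofFn fun j => (u j, β j)) ++ w))
        (birkhoffMinus (phiEval q)) (v.map fun b => (0, b))) =
      ∑ I ∈ (indexSet_finite hu m).toFinset,
        expL ℚ ^ (q * (∑ j, (β j : ℕ)) + expo β I) * psi q (q + lastIdx I) v := by
  simp only [psi, conv_eq_sum, map_sum, List.length_map]
  simp_rw [Finset.mul_sum _ (fun i => tailSum _ _ _ * _)]
  rw [Finset.sum_comm]
  refine Finset.sum_congr rfl fun i _ => ?_
  rw [← List.map_take, ← List.map_drop, birkhoffMinus_phiEval_map_zero, coeffL_mul,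
    coeffL_phiEval hu, Finset.sum_mul]
  simp only [mul_assoc]

lemma isReg_conv {r : ℕ} {u : Fin r → ℕ} (hu : EndsPos u) (β : Fin r → ℕ+) (v : List ℕ+) (q : ℕ) :
    IsReg (conv (fun w => phiEval q ((List.ofFn fun j => (u j, β j)) ++ w))
        (birkhoffMinus (phiEval q)) (v.map fun b => (0, b))) := by
  intro n hn
  refine MvPowerSeries.ext fun m => ?_
  rw [← coeff_coeffL, coeffL_conv hu,
    IsReg.sum _ (fun I _ => (isReg_expL_pow _).mul (isReg_psi q (lastIdx I) v)) n hn, map_zero]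

lemma endsPos_get {U : List Letter} (hU : ∀ h : U ≠ [], 0 < (U.getLast h).1) :
    EndsPos fun j => (U.get j).1 := by
  intro i hi
  have hne : U ≠ [] := List.ne_nil_of_length_pos (by omega)
  have := hU hne
  rw [List.getLast_eq_getElem] at this
  have hil : i = ⟨U.length - 1, by omega⟩ := Fin.ext (by simp; omega)
  rw [hil]
  exact this

/-- The polar factor vanishes on a word that contains a positive exponent: the sum over the indices
up to the last positive exponent is finite, and the inner sums are renormalized by the polar factor
of the words of zeros. -/
lemma birkhoffMinus_phiEval_eq_zero (q : ℕ) (v : List ℕ+) (U : List Letter) (hne : U ≠ [])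
    (hU : ∀ h : U ≠ [], 0 < (U.getLast h).1) :
    birkhoffMinus (phiEval q) (U ++ v.map fun b => (0, b)) = 0 := by
  induction hn : U.length using Nat.strong_induction_on generalizing U with
  | _ n ih =>
    cases U with
    | nil => exact absurd rfl hne
    | cons a l =>
      rw [List.cons_append, birkhoffMinus_cons, conv_append]
      · have := isReg_conv (endsPos_get hU) (fun j => ((a :: l).get j).2) v q
        rw [show (List.ofFn fun j => (((a :: l).get j).1, ((a :: l).get j).2)) = a :: l from
          List.ofFn_get (a :: l)] at this
        rw [show (fun w => phiEval q (a :: (l ++ w))) = fun w => phiEval q ((a :: l) ++ w) from rfl,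
          this.polarPart_eq_zero, neg_zero]
      · intro u' hu' hs
        have hs' : u' <:+ a :: l := hs.trans (List.suffix_cons a l)
        refine ih u'.length ?_ u' hu' (fun h => ?_) rfl
        · have := hs.length_le
          simp at hn
          omega
        · rw [hs'.getLast]
          exact hU _

lemma birkhoffPlus_phiEval {r : ℕ} {u : Fin r → ℕ} (hu : EndsPos u) (β : Fin r → ℕ+) (v : List ℕ+)
    (q : ℕ) : birkhoffPlus (phiEval q) ((List.ofFn fun j => (u j, β j)) ++ v.map fun b => (0, b)) =
      conv (fun w => phiEval q ((List.ofFn fun j => (u j, β j)) ++ w))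
        (birkhoffMinus (phiEval q)) (v.map fun b => (0, b)) := by
  refine conv_append _ _ _ _ fun u' hu' hs => birkhoffMinus_phiEval_eq_zero q v u' hu' fun h => ?_
  rw [hs.getLast, List.getLast_ofFn]
  exact hu _ (by
    have : (List.ofFn fun j => (u j, β j)) ≠ [] := fun h0 => hu' (by simpa [h0] using hs)
    have : r ≠ 0 := by
      rintro rfl
      simp at this
    simp
    omega)

/-- The empty word has a single index sequence, the empty one, of weight `1`. -/
lemma regularization_nil : regularization [] = 1 := by
  refine HahnSeries.ext (funext fun n => coeffEval_ext fun q m => ?_)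
  have h := congrArg (fun f => HahnSeries.coeff f n) (coeffEval_regularization (s := 0)
    (endsPos_fin_zero Fin.elim0) Fin.elim0 Fin.elim0 q m)
  have h0 : ∀ I : Fin 0 ↪o ℕ+, expL ℚ ^ (q * (∑ j, ((Fin.elim0 j : ℕ+) : ℕ)) + expo Fin.elim0 I) *
      tailSum (expL ℚ) (q + lastIdx I) (List.ofFn Fin.elim0) = 1 := fun I => by
    simp [expo, lastIdx]
  simp only [h0] at h
  rw [sum_indexSet_fin_zero (endsPos_fin_zero _), coeff_laurentMapAdd] at h
  refine Eq.trans (Eq.trans ?_ h) ?_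
  · rfl
  · rw [HahnSeries.coeff_one, coeffEval_apply]
    split_ifs <;> simp_all [HahnSeries.coeff_one, MvPowerSeries.coeff_one]

lemma phi_nil (R : Type*) [CommRing R] [Algebra ℚ R] : phi R [] = 1 := by
  rw [phi_eq, phi_rat, regularization_nil, map_one]

lemma phiPlus_eq (R : Type*) [CommRing R] [Algebra ℚ R] (w : List Letter) :
    phiPlus R w = birkhoffPlus (phi R) w := by
  cases w with
  | nil => rw [phiPlus, birkhoffPlus, conv, phi_nil, birkhoffMinus_nil, one_mul]
  | cons a l =>
    rw [birkhoffPlus_cons _ (phi_nil R), ← add_sum_eq_conv]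
    simp only [phiPlus, phiMinus_eq]

lemma birkhoffPlus_map {L A B : Type*} [CommRing A] [CommRing B] (ρ : A →+* B)
    (φ : List L → LaurentSeries A) (ψ : List L → LaurentSeries B)
    (h : ∀ w, ψ w = laurentMap ρ (φ w)) (w : List L) :
    birkhoffPlus ψ w = laurentMap ρ (birkhoffPlus φ w) := by
  have hm : ∀ w, birkhoffMinus ψ w = laurentMap ρ (birkhoffMinus φ w) := fun w => by
    simpa using birkhoffMinus_map ρ id φ ψ (by simpa using h) w
  simp only [birkhoffPlus, conv_eq_sum, map_sum, map_mul, h, hm]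

lemma Z_eq_map (R : Type*) [CommRing R] [Algebra ℚ R] {k : ℕ} (α : Fin k → ℕ) (β : Fin k → ℕ+) :
    Z R α β = Polynomial.mapRingHom (MvPowerSeries.map (σ := ℕ+) (algebraMap ℚ R)) (Z ℚ α β) := by
  rw [Z, Z, phiPlus_eq, phiPlus_eq, birkhoffPlus_map _ _ _ (phi_eq R)]
  rfl

/-- The values of the coefficients of `Z(α; β)` at natural numbers `t`, where the trailing zeros of
`α` have been split off: only the number of index sequences with a given last entry and the
directions at the trailing zeros matter. -/
lemma coeffEval_Z {r s : ℕ} {u : Fin r → ℕ} (hu : EndsPos u) (β : Fin r → ℕ+) (γ : Fin s → ℕ+)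
    (q : ℕ) (m : ℕ+ →₀ ℕ) :
    coeffEval q m (Z ℚ (Fin.append u fun _ => 0) (Fin.append β γ)) =
      ∑ I ∈ (indexSet_finite hu m).toFinset, chi q (q + lastIdx I) (List.ofFn γ) := by
  have h1 : coeffEval q m (Z ℚ (Fin.append u fun _ => 0) (Fin.append β γ)) =
      (coeffL m (birkhoffPlus (phiEval q)
        (List.ofFn fun j => (Fin.append u (fun _ : Fin s => 0) j, Fin.append β γ j)))).coeff 0 := by
    rw [birkhoffPlus_map (Polynomial.evalRingHom (q : PowX ℚ)) (phi ℚ) (phiEval q) fun _ => rfl,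
      ← phiPlus_eq]
    rfl
  rw [h1, word_append, birkhoffPlus_phiEval hu, coeffL_conv hu, HahnSeries.coeff_sum]
  refine Finset.sum_congr rfl fun I _ => ?_
  rw [(isReg_expL_pow _).coeff_zero_mul (isReg_psi q _ _), coeff_zero_expL_pow, one_mul, chi]

/-! ### Consequences for the directional quasisymmetric functions -/

section Consequences

variable {r s : ℕ} {u : Fin r → ℕ}

/-- The directions before the trailing zeros do not matter. -/
lemma Z_append_left (hu : EndsPos u) (β β' : Fin r → ℕ+) (γ : Fin s → ℕ+) :
    Z ℚ (Fin.append u fun _ => 0) (Fin.append β γ) =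
      Z ℚ (Fin.append u fun _ => 0) (Fin.append β' γ) :=
  coeffEval_ext fun q m => by rw [coeffEval_Z hu, coeffEval_Z hu]

/-- For constant directions at the trailing zeros the direction does not matter. -/
lemma Z_append_const (hu : EndsPos u) (β β' : Fin r → ℕ+) (δ δ' : ℕ+) :
    Z ℚ (Fin.append u fun _ => 0) (Fin.append β fun _ : Fin s => δ) =
      Z ℚ (Fin.append u fun _ => 0) (Fin.append β' fun _ : Fin s => δ') := by
  refine coeffEval_ext fun q m => ?_
  rw [coeffEval_Z hu, coeffEval_Z hu]
  refine Finset.sum_congr rfl fun I _ => ?_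
  have hs : (s.factorial : ℚ) ≠ 0 := Nat.cast_ne_zero.2 s.factorial_ne_zero
  exact mul_left_cancel₀ hs ((chi_const q _ s δ).trans (chi_const q _ s δ').symm)

/-- The symmetrization over the directions at the trailing zeros is `s!` times the value for
constant directions. -/
lemma sum_perm_Z (hu : EndsPos u) (β β' : Fin r → ℕ+) (γ : Fin s → ℕ+) (δ : ℕ+) :
    ∑ τ : Equiv.Perm (Fin s), Z ℚ (Fin.append u fun _ => 0) (Fin.append β fun i => γ (τ i)) =
      s.factorial • Z ℚ (Fin.append u fun _ => 0) (Fin.append β' fun _ : Fin s => δ) := by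
  refine coeffEval_ext fun q m => ?_
  rw [map_sum, map_nsmul, coeffEval_Z hu, Finset.smul_sum]
  simp only [coeffEval_Z hu]
  rw [Finset.sum_comm]
  refine Finset.sum_congr rfl fun I _ => ?_
  rw [sum_perm_chi, nsmul_eq_mul, chi_const]

lemma append_addDir (δ : ℕ+) : addDir (Fin.append u fun _ : Fin s => 0) δ =
    Fin.append (addDir u δ) fun _ => δ := by
  funext i
  induction i using Fin.addCases with
  | left i =>
    rw [Fin.append_left]
    exact PNat.eq (by simp [addDir])
  | right i =>
    rw [Fin.append_right]
    exact PNat.eq (by simp [addDir])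

lemma append_const {L : Type*} (δ : L) :
    Fin.append (fun _ : Fin r => δ) (fun _ : Fin s => δ) = fun _ => δ := by
  funext i
  induction i using Fin.addCases <;> simp

/-- The permutation of all positions that acts like `τ` on the last `s` positions. -/
def extendPerm (r : ℕ) {s : ℕ} (τ : Equiv.Perm (Fin s)) : Equiv.Perm (Fin (r + s)) :=
  finSumFinEquiv.permCongr (Equiv.sumCongr (Equiv.refl (Fin r)) τ)

lemma extendPerm_castAdd (τ : Equiv.Perm (Fin s)) (i : Fin r) :
    extendPerm r τ (Fin.castAdd s i) = Fin.castAdd s i := by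
  simp [extendPerm, Equiv.permCongr_apply]

lemma extendPerm_natAdd (τ : Equiv.Perm (Fin s)) (i : Fin s) :
    extendPerm r τ (Fin.natAdd r i) = Fin.natAdd r (τ i) := by
  simp [extendPerm, Equiv.permCongr_apply]

lemma extendPerm_injective : Function.Injective (extendPerm r (s := s)) := fun τ τ' h =>
  Equiv.ext fun i => by
    have := congrArg (fun σ : Equiv.Perm (Fin (r + s)) => σ (Fin.natAdd r i)) h
    simpa [extendPerm_natAdd] using this

/-- The permutations that fix every position up to the last positive entry are the extensions of
the permutations of the trailing positions. -/
lemma trailingPerms_append (hu : EndsPos u) : trailingPerms (Fin.append u fun _ : Fin s => 0) =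
    Finset.univ.map ⟨extendPerm r (s := s), extendPerm_injective⟩ := by
  ext σ
  simp only [trailingPerms, Finset.mem_filter, Finset.mem_univ, true_and, Finset.mem_map,
    Function.Embedding.coeFn_mk]
  constructor
  · intro h
    have hfix : ∀ i : Fin r, σ (Fin.castAdd s i) = Fin.castAdd s i := fun i => by
      have hr : 0 < r := i.pos
      refine h _ ⟨Fin.castAdd s ⟨r - 1, by omega⟩, ?_, ?_⟩
      · rw [Fin.le_def]
        simp
        omega
      · rw [Fin.append_left]
        exact hu _ (by simp; omega)
    have hmaps : Set.MapsTo (finSumFinEquiv.symm.permCongr σ)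
        (Set.range (Sum.inl : Fin r → Fin r ⊕ Fin s)) (Set.range Sum.inl) := by
      rintro _ ⟨i, rfl⟩
      exact ⟨i, by simp [Equiv.permCongr_apply, hfix]⟩
    obtain ⟨⟨a, τ⟩, hτ⟩ := Equiv.Perm.mem_sumCongrHom_range_of_perm_mapsTo_inl hmaps
    refine ⟨τ, Equiv.ext fun i => ?_⟩
    induction i using Fin.addCases with
    | left i => rw [extendPerm_castAdd, hfix]
    | right i =>
      rw [extendPerm_natAdd]
      have := congrArg (fun e : Equiv.Perm (Fin r ⊕ Fin s) => finSumFinEquiv (e (Sum.inr i))) hτ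
      simpa [Equiv.permCongr_apply] using this
  · rintro ⟨τ, rfl⟩ i ⟨i', hle, hpos⟩
    induction i using Fin.addCases with
    | left i => exact extendPerm_castAdd τ i
    | right i =>
      exfalso
      induction i' using Fin.addCases with
      | left i' =>
        have : r + (i : ℕ) ≤ i' := hle
        omega
      | right i' => simp at hpos

lemma card_trailingPerms (hu : EndsPos u) :
    (trailingPerms (Fin.append u fun _ : Fin s => 0)).card = s.factorial := by
  rw [trailingPerms_append hu, Finset.card_map, Finset.card_univ, Fintype.card_perm,
    Fintype.card_fin]

lemma symZ_append (hu : EndsPos u) (β β' : Fin r → ℕ+) (γ : Fin s → ℕ+) (δ : ℕ+) :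
    symZ ℚ (Fin.append u fun _ => 0) (Fin.append β γ) =
      s.factorial • Z ℚ (Fin.append u fun _ => 0) (Fin.append β' fun _ : Fin s => δ) := by
  rw [symZ, trailingPerms_append hu, Finset.sum_map, ← sum_perm_Z hu β β' γ δ]
  refine Finset.sum_congr rfl fun τ _ => ?_
  congr 1
  funext i
  induction i using Fin.addCases with
  | left i => simp [extendPerm_castAdd]
  | right i => simp [extendPerm_natAdd]

end Consequences

lemma endsPos_of_last {k : ℕ} {α : Fin (k + 1) → ℕ} (h : 0 < α (Fin.last k)) : EndsPos α := by
  intro i hi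
  rwa [show i = Fin.last k from Fin.ext (by simpa using hi)]

/-- Without trailing zeros the regularization needs no renormalization, and every index sequence
contributes `1` at `z = 0`. -/
lemma Z_eq_monomialQSym {r : ℕ} {u : Fin r → ℕ} (hu : EndsPos u) (β : Fin r → ℕ+) :
    Z ℚ u β = Polynomial.C (monomialQSym ℚ u) := by
  refine coeffEval_ext fun q m => ?_
  have h := coeffEval_Z (s := 0) hu β Fin.elim0 q m
  rw [show (Fin.append u fun _ : Fin 0 => 0) = u from funext fun i => Fin.append_left u _ i,
    show Fin.append β Fin.elim0 = β from funext fun i => Fin.append_left β _ i] at h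
  refine h.trans ?_
  simp only [List.ofFn_zero, chi_nil]
  rw [coeffEval_apply, Polynomial.eval_C, Finset.sum_const, nsmul_eq_mul, mul_one,
    ← Set.ncard_eq_toFinset_card _ (indexSet_finite hu m)]
  rfl

lemma map_monomialQSym (R : Type*) [CommRing R] [Algebra ℚ R] {k : ℕ} (α : Fin k → ℕ) :
    MvPowerSeries.map (algebraMap ℚ R) (monomialQSym ℚ α) = monomialQSym R α := by
  ext m
  rw [MvPowerSeries.coeff_map]
  exact map_natCast (algebraMap ℚ R) _

lemma Z_addDir (R : Type*) [CommRing R] [Algebra ℚ R] {k : ℕ} (α : Fin k → ℕ) (δ δ' : ℕ+) :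
    Z R α (addDir α δ) = Z R α fun _ => δ' := by
  obtain ⟨r, s, rfl, u, hu, h⟩ := exists_eq_append α
  obtain rfl : α = Fin.append u fun _ => 0 := funext h
  rw [Z_eq_map, Z_eq_map R _ fun _ => δ', append_addDir, ← append_const δ',
    Z_append_const hu _ (fun _ => δ') δ δ']

lemma Z_addDir_eq_symZ (R : Type*) [CommRing R] [Algebra ℚ R] {k : ℕ} (α : Fin k → ℕ)
    (β : Fin k → ℕ+) (δ : ℕ+) :
    Z R α (addDir α δ) = ((trailingPerms α).card : ℚ)⁻¹ • symZ R α β := by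
  obtain ⟨r, s, rfl, u, hu, h⟩ := exists_eq_append α
  obtain rfl : α = Fin.append u fun _ => 0 := funext h
  have hsym : symZ R (Fin.append u fun _ : Fin s => 0) β = s.factorial •
      Z R (Fin.append u fun _ : Fin s => 0) (addDir (Fin.append u fun _ => 0) δ) := by
    rw [Z_eq_map R _ (addDir _ _), ← map_nsmul, append_addDir,
      ← symZ_append hu (fun i => β (Fin.castAdd s i)) _ (fun i => β (Fin.natAdd r i)),
      Fin.append_castAdd_natAdd, symZ, symZ, map_sum]
    exact Finset.sum_congr rfl fun σ _ => Z_eq_map R _ _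
  have hs : (s.factorial : ℚ) ≠ 0 := Nat.cast_ne_zero.2 s.factorial_ne_zero
  rw [hsym, card_trailingPerms hu, ← Nat.cast_smul_eq_nsmul ℚ, smul_smul, inv_mul_cancel₀ hs,
    one_smul]

end RenQSym

theorem mainTheorem2 (R : Type*) [CommRing R] [Algebra ℚ R] :
    -- every series has exactly one expansion, so that `φ`, `φ₋`, `φ₊` and `Z` are well defined
    (∀ (k : ℕ) (α : Fin k → ℕ) (β : Fin k → ℕ+), ∃! Φ, RenQSym.IsRegularization α β Φ) ∧
    -- (1)
    (∀ (k : ℕ) (α : Fin (k + 1) → ℕ) (δ : ℕ+), 0 < α (Fin.last k) →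
      (∀ m, (RenQSym.indexSet α m).Finite) ∧
      RenQSym.Z R α (RenQSym.addDir α δ) = Polynomial.C (RenQSym.monomialQSym R α)) ∧
    -- (2)
    (∀ (k : ℕ) (α : Fin (k + 1) → ℕ) (δ : ℕ+), α (Fin.last k) = 0 →
      ∀ β : Fin (k + 1) → ℕ+,
        RenQSym.Z R α (RenQSym.addDir α δ) =
          (((RenQSym.trailingPerms α).card : ℚ)⁻¹) • RenQSym.symZ R α β) ∧
    -- (3)
    (∀ (k : ℕ) (α : Fin (k + 1) → ℕ) (δ : ℕ+), 0 < α (Fin.last k) →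
      ∀ (s : ℕ) (β : Fin (k + 1) → ℕ+),
        RenQSym.Z R (Fin.append α fun _ : Fin s => 0) (Fin.append β fun _ : Fin s => δ) =
          RenQSym.Z R (Fin.append α fun _ : Fin s => 0) fun _ => δ) ∧
    -- (4)
    (∀ (k : ℕ) (α : Fin k → ℕ) (δ : ℕ+),
      RenQSym.Z R α (RenQSym.addDir α δ) = RenQSym.Z R α fun _ => δ) ∧
    -- the common value in (4) does not depend on the choice of `δ`
    (∀ (k : ℕ) (α : Fin k → ℕ) (δ δ' : ℕ+),
      RenQSym.Z R α (fun _ => δ) = RenQSym.Z R α fun _ => δ') := by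
  refine ⟨fun k α β => ?_, fun k α δ h => ⟨?_, ?_⟩, fun k α δ _ β => ?_, fun k α δ h s β => ?_,
    fun k α δ => ?_, fun k α δ δ' => ?_⟩
  · obtain ⟨Φ, hΦ⟩ := RenQSym.exists_isRegularization α β
    exact ⟨Φ, hΦ, fun Ψ hΨ => hΨ.unique hΦ⟩
  · exact RenQSym.indexSet_finite (RenQSym.endsPos_of_last h)
  · rw [RenQSym.Z_eq_map, RenQSym.Z_eq_monomialQSym (RenQSym.endsPos_of_last h),
      Polynomial.coe_mapRingHom, Polynomial.map_C, RenQSym.map_monomialQSym]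
  · exact RenQSym.Z_addDir_eq_symZ R α β δ
  · rw [RenQSym.Z_eq_map, RenQSym.Z_eq_map R _ fun _ => δ, ← RenQSym.append_const δ,
      RenQSym.Z_append_left (RenQSym.endsPos_of_last h) β fun _ => δ]
  · exact RenQSym.Z_addDir R α δ δ
  · exact (RenQSym.Z_addDir R α δ δ).symm.trans (RenQSym.Z_addDir R α δ δ')
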